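/- Let $K$ be a field and let $E=(E^0,E^1,r,s)$ be a directed graph with countable sets $E^0$ of vertices and $E^1$ of edges and with range and source maps $r,s:E^1\to E^0$ (no finiteness condition is imposed on $E$). A vertex $v$ is regular if $s^{-1}(v)$ is finite and nonempty. The Leavitt path algebra $L_K(E)$ is the associative, not necessarily unital, $K$-algebra generated by pairwise orthogonal idempotents $v$ ($v\in E^0$) together with elements $e,e^*$ ($e\in E^1$), subject to the relations $s(e)e=er(e)=e$ and $r(e)e^*=e^*s(e)=e^*$ for all $e\in E^1$, $e^*f=\delta_{e,f}\,r(e)$ for all $e,f\in E^1$, and $v=\sum_{s(e)=v}ee^*$ for every regular vertex $v$. For $v\in E^0$ let $T(v)$ be the set of all $w\in E^0$ such that there is a path (possibly of length $0$) from $v$ to $w$. A cycle based at $w$ is a path $e_1\cdots e_n$ with $n\ge 1$ from $w$ to $w$ such that $s(e_i)\neq s(e_j)$ for $i\ne j$. A vertex $u$ is a line point if, for every $w\in T(u)$, $w$ emits at most one edge and there is no cycle based at $w$; let $P_l(E)$ be the set of line points. A set $H\subseteq E^0$ is hereditary if $T(v)\subseteq H$ for all $v\in H$, and saturated if it contains every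 regular vertex $v$ with $r(s^{-1}(v))\subseteq H$. For $X\subseteq E^0$ let $I(X)$ be the two-sided ideal of $L_K(E)$ generated by $X$. The socle $\operatorname{Soc}(L_K(E))$ is the sum of all minimal left ideals of $L_K(E)$, which coincides with the sum of all minimal right ideals (it is $0$ if there are none). Theorem. The sum of all minimal left ideals and the sum of all minimal right ideals of $L_K(E)$ are equal, and $$\operatorname{Soc}(L_K(E))=I(P_l(E))=I(H),$$ where $H$ is the hereditary and saturated closure of $P_l(E)$, that is, the smallest hereditary and saturated subset of $E^0$ that contains $P_l(E)$. -/

import Mathlib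

/-- A directed graph with vertex set `V` and edge set `A`; loops and parallel edges are allowed. -/
structure DirGraph (V A : Type*) where
  /-- The source map. -/
  s : A → V
  /-- The range map. -/
  r : A → V

namespace DirGraph

variable {V A : Type*} (E : DirGraph V A)

/-- `E.IsPath u p w`: the list of edges `p = [e₁, …, eₙ]` is a path with source `u` and range `w`.
The empty list is the path of length zero at a vertex. -/
inductive IsPath : V → List A → V → Prop
  | nil (v : V) : IsPath v [] v
  | cons (e : A) {p : List A} {w : V} (h : IsPath (E.r e) p w) : IsPath (E.s e) (e :: p) w

/-- The tree `T(v)`: all vertices `w` for which there is a path from `v` to `w`. -/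
def tree (v : V) : Set V := {w | ∃ p, E.IsPath v p w}

/-- There is a bifurcation at `v`: the vertex `v` emits at least two edges. -/
def IsBifurcation (v : V) : Prop := {e | E.s e = v}.Nontrivial

/-- `p = [e₁, …, eₙ]` is a cycle based at `v`: a path of positive length from `v` to `v` such that
`s(eᵢ) ≠ s(eⱼ)` for `i ≠ j`. -/
def IsCycleAt (v : V) (p : List A) : Prop :=
  p ≠ [] ∧ E.IsPath v p v ∧ (p.map E.s).Nodup

/-- The set `P_l(E)` of line points: the vertices `u` such that there are neither bifurcations nor
cycles at any vertex of `T(u)`. -/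
def linePoints : Set V :=
  {u | ∀ w ∈ E.tree u, ¬ E.IsBifurcation w ∧ ∀ p, ¬ E.IsCycleAt w p}

/-- A vertex is regular if it emits at least one and only finitely many edges. -/
def IsRegular (v : V) : Prop := {e | E.s e = v}.Finite ∧ {e | E.s e = v}.Nonempty

/-- `H` is hereditary if every vertex that can be reached from `H` lies in `H`. -/
def IsHereditary (H : Set V) : Prop := ∀ v ∈ H, E.tree v ⊆ H

/-- `H` is saturated if it contains every regular vertex all of whose edges end in `H`. -/
def IsSaturated (H : Set V) : Prop :=
  ∀ v, E.IsRegular v → (∀ e, E.s e = v → E.r e ∈ H) → v ∈ H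

/-- The hereditary saturated closure of `X`: the smallest hereditary and saturated set of vertices
that contains `X`. -/
def hsClosure (X : Set V) : Set V :=
  ⋂₀ {H | X ⊆ H ∧ E.IsHereditary H ∧ E.IsSaturated H}

end DirGraph

/-- The generators of a Leavitt path algebra: vertices `v`, edges `e` and ghost edges `e*`. -/
inductive LeavittGen (V A : Type*)
  | vertex (v : V)
  | edge (e : A)
  | ghost (e : A)

/-- The free associative, not necessarily unital, `K`-algebra on the vertices, edges and ghost
edges: its basis consists of the nonempty words in these letters. -/
abbrev LeavittFree (K V A : Type*) [Field K] : Type _ :=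
  MonoidAlgebra K (FreeSemigroup (LeavittGen V A))

namespace LeavittFree

variable (K : Type*) {V A : Type*} [Field K]

/-- A letter, as an element of the free algebra. -/
noncomputable def of (x : LeavittGen V A) : LeavittFree K V A :=
  MonoidAlgebra.single (FreeSemigroup.of x) 1

/-- The letter `v`. -/
noncomputable def vertex (v : V) : LeavittFree K V A := of K (.vertex v)

/-- The letter `e`. -/
noncomputable def edge (e : A) : LeavittFree K V A := of K (.edge e)

/-- The letter `e*`. -/
noncomputable def ghost (e : A) : LeavittFree K V A := of K (.ghost e)

end LeavittFree

namespace DirGraph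

variable (K : Type*) [Field K] {V A : Type*} (E : DirGraph V A)

open LeavittFree in
/-- The defining relations of the Leavitt path algebra. -/
inductive LeavittRel : LeavittFree K V A → LeavittFree K V A → Prop
  | vertex_idem (v : V) : LeavittRel (vertex K v * vertex K v) (vertex K v)
  | vertex_orth (v w : V) (h : v ≠ w) : LeavittRel (vertex K v * vertex K w) 0
  | source_edge (e : A) : LeavittRel (vertex K (E.s e) * edge K e) (edge K e)
  | edge_range (e : A) : LeavittRel (edge K e * vertex K (E.r e)) (edge K e)
  | range_ghost (e : A) : LeavittRel (vertex K (E.r e) * ghost K e) (ghost K e)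
  | ghost_source (e : A) : LeavittRel (ghost K e * vertex K (E.s e)) (ghost K e)
  | ghost_edge_self (e : A) : LeavittRel (ghost K e * edge K e) (vertex K (E.r e))
  | ghost_edge_ne (e f : A) (h : e ≠ f) : LeavittRel (ghost K e * edge K f) 0
  | regular (v : V) (h : E.IsRegular v) :
      LeavittRel (vertex K v) (∑ e ∈ h.1.toFinset, edge K e * ghost K e)

/-- The congruence generated by all scalar multiples of the defining relations. Its zero class is
the two-sided algebra ideal generated by the relations; the scalars have to be put in explicitly,
as the free algebra has no unit. -/
noncomputable def leavittCon : RingCon (LeavittFree K V A) :=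
  ringConGen fun x y => ∃ (k : K) (a b : LeavittFree K V A),
    E.LeavittRel K a b ∧ x = k • a ∧ y = k • b

theorem leavittCon_smul (k : K) {x y : LeavittFree K V A} (h : E.leavittCon K x y) :
    E.leavittCon K (k • x) (k • y) := by
  change RingConGen.Rel _ x y at h
  induction h with
  | of x y h =>
    obtain ⟨l, a, b, hab, rfl, rfl⟩ := h
    exact RingConGen.Rel.of _ _ ⟨k * l, a, b, hab, smul_smul .., smul_smul ..⟩
  | refl x => exact (E.leavittCon K).refl _
  | symm _ ih => exact (E.leavittCon K).symm ih
  | trans _ _ ih₁ ih₂ => exact (E.leavittCon K).trans ih₁ ih₂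
  | add _ _ ih₁ ih₂ =>
    rw [smul_add, smul_add]
    exact (E.leavittCon K).add ih₁ ih₂
  | mul _ h₂ ih₁ _ =>
    rw [← smul_mul_assoc, ← smul_mul_assoc]
    exact (E.leavittCon K).mul ih₁ h₂

/-- The Leavitt path algebra `L_K(E)`: the (not necessarily unital) associative `K`-algebra
generated by the vertices, the edges and the ghost edges, subject to the defining relations. -/
def LeavittPathAlgebra : Type _ := (E.leavittCon K).Quotient

namespace LeavittPathAlgebra

noncomputable instance : NonUnitalRing (E.LeavittPathAlgebra K) :=
  inferInstanceAs (NonUnitalRing (E.leavittCon K).Quotient)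

/-- The quotient map from the free algebra. -/
noncomputable def mk (x : LeavittFree K V A) : E.LeavittPathAlgebra K :=
  RingCon.toQuotient (c := E.leavittCon K) x

noncomputable instance : SMul K (E.LeavittPathAlgebra K) where
  smul k := Quotient.map (fun x => k • x) fun _ _ h => E.leavittCon_smul K k h

noncomputable instance : Module K (E.LeavittPathAlgebra K) where
  one_smul := by rintro ⟨x⟩; exact congrArg (mk K E) (one_smul K x)
  mul_smul k l := by rintro ⟨x⟩; exact congrArg (mk K E) (mul_smul k l x)
  smul_zero k := congrArg (mk K E) (smul_zero k)
  smul_add k := by rintro ⟨x⟩ ⟨y⟩; exact congrArg (mk K E) (smul_add k x y)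
  add_smul k l := by rintro ⟨x⟩; exact congrArg (mk K E) (add_smul k l x)
  zero_smul := by rintro ⟨x⟩; exact congrArg (mk K E) (zero_smul K x)

instance : IsScalarTower K (E.LeavittPathAlgebra K) (E.LeavittPathAlgebra K) where
  smul_assoc k := by rintro ⟨x⟩ ⟨y⟩; exact congrArg (mk K E) (smul_mul_assoc k x y)

instance : SMulCommClass K (E.LeavittPathAlgebra K) (E.LeavittPathAlgebra K) where
  smul_comm k := by rintro ⟨x⟩ ⟨y⟩; exact congrArg (mk K E) (mul_smul_comm k x y).symm

/-- The vertex `v`, as an element of `L_K(E)`. -/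
noncomputable def vertex (v : V) : E.LeavittPathAlgebra K := mk K E (LeavittFree.vertex K v)

/-- The two-sided ideal `I(X)` of `L_K(E)` generated by a set `X` of vertices. -/
noncomputable def idealOf (X : Set V) : TwoSidedIdeal (E.LeavittPathAlgebra K) :=
  TwoSidedIdeal.span (vertex K E '' X)

end LeavittPathAlgebra

end DirGraph

section Socle

variable (R : Type*) [NonUnitalRing R]

/-- A left ideal of a (not necessarily unital) ring. -/
def IsLeftIdeal (I : AddSubgroup R) : Prop := ∀ a : R, ∀ x ∈ I, a * x ∈ I

/-- A right ideal of a (not necessarily unital) ring. -/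
def IsRightIdeal (I : AddSubgroup R) : Prop := ∀ a : R, ∀ x ∈ I, x * a ∈ I

/-- A minimal left ideal: a nonzero left ideal `I` such that `0` and `I` are the only left ideals
contained in `I`. -/
def IsMinimalLeftIdeal (I : AddSubgroup R) : Prop :=
  IsLeftIdeal R I ∧ I ≠ ⊥ ∧ ∀ J : AddSubgroup R, IsLeftIdeal R J → J ≤ I → J = ⊥ ∨ J = I

/-- A minimal right ideal: a nonzero right ideal `I` such that `0` and `I` are the only right ideals
contained in `I`. -/
def IsMinimalRightIdeal (I : AddSubgroup R) : Prop :=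
  IsRightIdeal R I ∧ I ≠ ⊥ ∧ ∀ J : AddSubgroup R, IsRightIdeal R J → J ≤ I → J = ⊥ ∨ J = I

/-- The left socle: the sum of all minimal left ideals (zero if there are none). -/
def leftSocle : AddSubgroup R := sSup {I | IsMinimalLeftIdeal R I}

/-- The right socle: the sum of all minimal right ideals (zero if there are none). -/
def rightSocle : AddSubgroup R := sSup {I | IsMinimalRightIdeal R I}

end Socle

/-! Write `L` for the algebra. Both inclusions rest on a reduction: on elements without ghost edges,
multiplication by the ghost of a shortest path leaves `k v` with `k ≠ 0` plus closed paths at `v`.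

Line points lie in the socle (`exists_eq_mul_of_mem_linePoints`). Along the tree of a line point
every edge satisfies `s(e) = e e*`, so ghost edges can be removed by right multiplication without
loss. The shortest path then leaves only `k v`, since there are no closed paths at `v`. Hence every
nonzero element of `L v` generates `v`, and `L v` is minimal. The left socle is a two-sided ideal,
so it contains the ideal of the line points.

Conversely, let `x ≠ 0` lie in a minimal left ideal `M`. By `hasCornerReduction` some `a x b` equals
`k v` plus closed paths at `v`, and the closed paths are absent unless the tree of `v` has no
bifurcation. Put `m = a x`, which generates `M`. If `m b = k v`, a bifurcation below `v` would
provide orthogonal ghost paths, and the nonzero multiple of `m` by one of them could not generate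
`m`. If there is no bifurcation but a closed path `p` of length `n`, a representation over the
Laurent polynomials turns `p` into `T ^ n`; then `(v - p) m` is nonzero but cannot generate `m`,
because `1 - T ^ n` is not a unit (`not_isMinimalLeftIdeal_of_closed`). What remains is that `v` is
a line point and `x = y m = y v m` lies in its ideal.

The involution fixes the vertices and exchanges left and right ideals, which settles the right
socle. -/

namespace DirGraph.LeavittPathAlgebra

/-! ### Generators, universal property and involution -/

variable {K : Type*} [Field K] {V A : Type*} {E : DirGraph V A}

variable (K E) in
/-- The edge `e`, as an element of `L_K(E)`. -/
noncomputable def edge (e : A) : E.LeavittPathAlgebra K := mk K E (LeavittFree.edge K e)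

variable (K E) in
/-- The ghost edge `e*`, as an element of `L_K(E)`. -/
noncomputable def ghost (e : A) : E.LeavittPathAlgebra K := mk K E (LeavittFree.ghost K e)

theorem mk_add (x y : LeavittFree K V A) : mk K E (x + y) = mk K E x + mk K E y := rfl
theorem mk_zero : mk K E 0 = 0 := rfl

theorem mk_surjective : Function.Surjective (mk K E) := Quotient.mk_surjective

theorem mk_sum {ι : Type*} (s : Finset ι) (f : ι → LeavittFree K V A) :
    mk K E (∑ i ∈ s, f i) = ∑ i ∈ s, mk K E (f i) :=
  map_sum (⟨⟨mk K E, mk_zero⟩, mk_add⟩ : LeavittFree K V A →+ E.LeavittPathAlgebra K) f s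

theorem mk_eq_of_rel {x y : LeavittFree K V A} (h : E.LeavittRel K x y) :
    mk K E x = mk K E y :=
  Quotient.sound (RingConGen.Rel.of _ _ ⟨1, x, y, h, (one_smul ..).symm, (one_smul ..).symm⟩)

theorem vertex_mul_self (v : V) : vertex K E v * vertex K E v = vertex K E v :=
  mk_eq_of_rel (.vertex_idem v)

theorem vertex_mul_of_ne {v w : V} (h : v ≠ w) : vertex K E v * vertex K E w = 0 :=
  mk_eq_of_rel (.vertex_orth v w h)

theorem source_mul_edge (e : A) : vertex K E (E.s e) * edge K E e = edge K E e :=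
  mk_eq_of_rel (.source_edge e)

theorem edge_mul_range (e : A) : edge K E e * vertex K E (E.r e) = edge K E e :=
  mk_eq_of_rel (.edge_range e)

theorem range_mul_ghost (e : A) : vertex K E (E.r e) * ghost K E e = ghost K E e :=
  mk_eq_of_rel (.range_ghost e)

theorem ghost_mul_source (e : A) : ghost K E e * vertex K E (E.s e) = ghost K E e :=
  mk_eq_of_rel (.ghost_source e)

theorem ghost_mul_edge_self (e : A) : ghost K E e * edge K E e = vertex K E (E.r e) :=
  mk_eq_of_rel (.ghost_edge_self e)

theorem ghost_mul_edge_of_ne {e f : A} (h : e ≠ f) : ghost K E e * edge K E f = 0 :=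
  mk_eq_of_rel (.ghost_edge_ne e f h)

theorem vertex_eq_sum {v : V} (h : E.IsRegular v) :
    vertex K E v = ∑ e ∈ h.1.toFinset, edge K E e * ghost K E e :=
  (mk_eq_of_rel (.regular v h)).trans (mk_sum _ _)

theorem vertex_mul_edge_of_ne {v : V} {e : A} (h : v ≠ E.s e) : vertex K E v * edge K E e = 0 := by
  rw [← source_mul_edge, ← mul_assoc, vertex_mul_of_ne h, zero_mul]

theorem ghost_mul_vertex_of_ne {v : V} {e : A} (h : E.s e ≠ v) :
    ghost K E e * vertex K E v = 0 := by
  rw [← ghost_mul_source, mul_assoc, vertex_mul_of_ne h, mul_zero]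

/-- Every element of `L_K(E)` is obtained from `0` by sums, scalar multiples of the generators and
left multiplication by the generators. -/
theorem generator_induction {p : E.LeavittPathAlgebra K → Prop} (zero : p 0)
    (add : ∀ x y, p x → p y → p (x + y)) (smul : ∀ (k : K) x, p x → p (k • x))
    (vertex : ∀ v, p (vertex K E v)) (edge : ∀ e, p (edge K E e)) (ghost : ∀ e, p (ghost K E e))
    (vertex_mul : ∀ v x, p x → p (LeavittPathAlgebra.vertex K E v * x))
    (edge_mul : ∀ e x, p x → p (LeavittPathAlgebra.edge K E e * x))
    (ghost_mul : ∀ e x, p x → p (LeavittPathAlgebra.ghost K E e * x))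
    (x : E.LeavittPathAlgebra K) : p x := by
  obtain ⟨x, rfl⟩ := mk_surjective x
  have key : ∀ w : FreeSemigroup (LeavittGen V A), p (mk K E (MonoidAlgebra.single w 1)) := by
    intro w
    induction w using FreeSemigroup.recOnMul with
    | ih1 g => cases g with
      | vertex v => exact vertex v
      | edge e => exact edge e
      | ghost e => exact ghost e
    | ih2 g w _ ih =>
      have : MonoidAlgebra.single (FreeSemigroup.of g * w) (1 : K) =
          LeavittFree.of K g * MonoidAlgebra.single w 1 := by
        rw [LeavittFree.of, MonoidAlgebra.single_mul_single, one_mul]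
      rw [this]
      cases g with
      | vertex v => exact vertex_mul v _ ih
      | edge e => exact edge_mul e _ ih
      | ghost e => exact ghost_mul e _ ih
  induction x using MonoidAlgebra.induction_linear with
  | zero => exact zero
  | add x y hx hy => exact add _ _ hx hy
  | single w k =>
    have : (MonoidAlgebra.single w k : LeavittFree K V A) = k • MonoidAlgebra.single w 1 := by
      rw [MonoidAlgebra.smul_single, smul_eq_mul, mul_one]
    rw [this]
    exact smul _ _ (key w)

section Lift

variable {B : Type*} [NonUnitalRing B] [Module K B] [IsScalarTower K B B] [SMulCommClass K B B]

variable (K) in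
/-- The homomorphism from the free algebra given by the images of the letters. -/
noncomputable def freeLift (g : LeavittGen V A → B) : LeavittFree K V A →ₙₐ[K] B :=
  MonoidAlgebra.liftMagma K (FreeSemigroup.lift g)

theorem freeLift_of (g : LeavittGen V A → B) (x : LeavittGen V A) :
    freeLift K g (LeavittFree.of K x) = g x := by
  simp [freeLift, LeavittFree.of, MonoidAlgebra.liftMagma]

/-- The universal property of `L_K(E)`: a homomorphism from the free algebra that respects the
defining relations descends. -/
noncomputable def lift (g : LeavittGen V A → B)
    (h : ∀ x y, E.LeavittRel K x y → freeLift K g x = freeLift K g y) :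
    E.LeavittPathAlgebra K →ₙₐ[K] B :=
  have key : ∀ x y, E.leavittCon K x y → freeLift K g x = freeLift K g y := by
    intro x y hxy
    change RingConGen.Rel _ x y at hxy
    induction hxy with
    | of x y hxy =>
      obtain ⟨k, a, b, hab, rfl, rfl⟩ := hxy
      rw [map_smul, map_smul, h a b hab]
    | refl => rfl
    | symm _ ih => exact ih.symm
    | trans _ _ ih₁ ih₂ => exact ih₁.trans ih₂
    | add _ _ ih₁ ih₂ => rw [map_add, map_add, ih₁, ih₂]
    | mul _ _ ih₁ ih₂ => rw [map_mul, map_mul, ih₁, ih₂]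
  { toFun := Quotient.lift (freeLift K g) key
    map_smul' := by rintro k ⟨x⟩; exact map_smul (freeLift K g) k x
    map_zero' := map_zero (freeLift K g)
    map_add' := by rintro ⟨x⟩ ⟨y⟩; exact map_add (freeLift K g) x y
    map_mul' := by rintro ⟨x⟩ ⟨y⟩; exact map_mul (freeLift K g) x y }

variable {g : LeavittGen V A → B}
  {h : ∀ x y, E.LeavittRel K x y → freeLift K g x = freeLift K g y}

theorem lift_vertex (v : V) : lift g h (vertex K E v) = g (.vertex v) := freeLift_of g _
theorem lift_edge (e : A) : lift g h (edge K E e) = g (.edge e) := freeLift_of g _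
theorem lift_ghost (e : A) : lift g h (ghost K E e) = g (.ghost e) := freeLift_of g _

end Lift

/-- A map on letters, given by its values on vertices, edges and ghost edges. -/
def letterMap {B : Type*} (vtx : V → B) (edg gst : A → B) : LeavittGen V A → B
  | .vertex v => vtx v
  | .edge e => edg e
  | .ghost e => gst e

/-- Images of the letters that satisfy the defining relations satisfy the hypothesis of `lift`. -/
theorem freeLift_eq_of_rel {B : Type*} [NonUnitalRing B] [Module K B] [IsScalarTower K B B]
    [SMulCommClass K B B] (vtx : V → B) (edg gst : A → B)
    (hv : ∀ v, vtx v * vtx v = vtx v) (hvw : ∀ v w, v ≠ w → vtx v * vtx w = 0)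
    (hse : ∀ e, vtx (E.s e) * edg e = edg e) (her : ∀ e, edg e * vtx (E.r e) = edg e)
    (hrg : ∀ e, vtx (E.r e) * gst e = gst e) (hgs : ∀ e, gst e * vtx (E.s e) = gst e)
    (hge : ∀ e, gst e * edg e = vtx (E.r e)) (hgf : ∀ e f, e ≠ f → gst e * edg f = 0)
    (hreg : ∀ v (h : E.IsRegular v), vtx v = ∑ e ∈ h.1.toFinset, edg e * gst e)
    (x y : LeavittFree K V A) (hxy : E.LeavittRel K x y) :
    freeLift K (letterMap vtx edg gst) x = freeLift K (letterMap vtx edg gst) y := by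
  cases hxy with
  | regular v h =>
    simp only [map_sum, map_mul, LeavittFree.vertex, LeavittFree.edge, LeavittFree.ghost,
      freeLift_of, letterMap, hreg v h]
  | _ => simp [LeavittFree.vertex, LeavittFree.edge, LeavittFree.ghost, freeLift_of, letterMap, *]

variable (K E) in
/-- The involution of `L_K(E)`, as a homomorphism to the opposite algebra. -/
noncomputable def starHom : E.LeavittPathAlgebra K →ₙₐ[K] (E.LeavittPathAlgebra K)ᵐᵒᵖ :=
  lift (letterMap (fun v => .op (vertex K E v)) (fun e => .op (ghost K E e))
      (fun e => .op (edge K E e))) <| by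
    apply freeLift_eq_of_rel
    · intro v; rw [← MulOpposite.op_mul, vertex_mul_self]
    · intro v w h; rw [← MulOpposite.op_mul, vertex_mul_of_ne h.symm, MulOpposite.op_zero]
    · intro e; rw [← MulOpposite.op_mul, ghost_mul_source]
    · intro e; rw [← MulOpposite.op_mul, range_mul_ghost]
    · intro e; rw [← MulOpposite.op_mul, edge_mul_range]
    · intro e; rw [← MulOpposite.op_mul, source_mul_edge]
    · intro e; rw [← MulOpposite.op_mul, ghost_mul_edge_self]
    · intro e f h; rw [← MulOpposite.op_mul, ghost_mul_edge_of_ne h.symm, MulOpposite.op_zero]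
    · intro v h; simp only [← MulOpposite.op_mul, ← Finset.op_sum, vertex_eq_sum h]

noncomputable instance : Star (E.LeavittPathAlgebra K) := ⟨fun x => (starHom K E x).unop⟩

theorem star_vertex (v : V) : star (vertex K E v) = vertex K E v :=
  congrArg MulOpposite.unop (lift_vertex v)

theorem star_edge (e : A) : star (edge K E e) = ghost K E e :=
  congrArg MulOpposite.unop (lift_edge e)

theorem star_ghost (e : A) : star (ghost K E e) = edge K E e :=
  congrArg MulOpposite.unop (lift_ghost e)

-- The double star is an endomorphism fixing the generators, so involutivity reduces to
-- `generator_induction`.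
noncomputable instance : StarRing (E.LeavittPathAlgebra K) :=
  have mul : ∀ x y : E.LeavittPathAlgebra K, star (x * y) = star y * star x := fun x y =>
    congrArg MulOpposite.unop (map_mul (starHom K E) x y)
  have add : ∀ x y : E.LeavittPathAlgebra K, star (x + y) = star x + star y := fun x y =>
    congrArg MulOpposite.unop (map_add (starHom K E) x y)
  have smul : ∀ (k : K) (x : E.LeavittPathAlgebra K), star (k • x) = k • star x := fun k x =>
    congrArg MulOpposite.unop (map_smul (starHom K E) k x)
  have zero : star (0 : E.LeavittPathAlgebra K) = 0 :=
    congrArg MulOpposite.unop (map_zero (starHom K E))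
  { star_mul := mul
    star_add := add
    star_involutive := by
      intro x
      induction x using generator_induction with
      | zero => rw [zero, zero]
      | add x y hx hy => rw [add, add, hx, hy]
      | smul k x hx => rw [smul, smul, hx]
      | vertex v => rw [star_vertex, star_vertex]
      | edge e => rw [star_edge, star_ghost]
      | ghost e => rw [star_ghost, star_edge]
      | vertex_mul v x hx => rw [mul, mul, hx, star_vertex, star_vertex]
      | edge_mul e x hx => rw [mul, mul, hx, star_edge, star_ghost]
      | ghost_mul e x hx => rw [mul, mul, hx, star_ghost, star_edge] }

end DirGraph.LeavittPathAlgebra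

/-! ### Paths and cycles -/

namespace DirGraph

variable {V A : Type*} {E : DirGraph V A}

namespace IsPath

theorem eq_of_nil {u w : V} (h : E.IsPath u [] w) : u = w := by cases h; rfl

theorem source_eq {u w : V} {e : A} {p : List A} (h : E.IsPath u (e :: p) w) : u = E.s e := by
  cases h; rfl

theorem tail {u w : V} {e : A} {p : List A} (h : E.IsPath u (e :: p) w) :
    E.IsPath (E.r e) p w := by
  cases h; assumption

theorem single (e : A) : E.IsPath (E.s e) [e] (E.r e) := .cons e (.nil _)

theorem append {u x w : V} {p q : List A} (hp : E.IsPath u p x) (hq : E.IsPath x q w) :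
    E.IsPath u (p ++ q) w := by
  induction hp with
  | nil => exact hq
  | cons e _ ih => exact .cons e (ih hq)

theorem of_append {u w : V} {p q : List A} (h : E.IsPath u (p ++ q) w) :
    ∃ x, E.IsPath u p x ∧ E.IsPath x q w := by
  induction p generalizing u with
  | nil => exact ⟨u, .nil u, h⟩
  | cons e p ih =>
    obtain ⟨x, hp, hq⟩ := ih h.tail
    exact ⟨x, h.source_eq ▸ .cons e hp, hq⟩

theorem range_unique {u w w' : V} {p : List A} (h : E.IsPath u p w) (h' : E.IsPath u p w') :
    w = w' := by
  induction h with
  | nil => exact h'.eq_of_nil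
  | cons e _ ih => exact ih h'.tail

/-- The remainder of a path after an initial segment. -/
theorem of_append_right {u x w : V} {p q : List A} (hp : E.IsPath u p x)
    (h : E.IsPath u (p ++ q) w) : E.IsPath x q w := by
  obtain ⟨y, hy, hq⟩ := h.of_append
  rwa [hp.range_unique hy]

end IsPath

theorem mem_tree_self (v : V) : v ∈ E.tree v := ⟨[], .nil v⟩

theorem tree_subset_of_mem {v w : V} (h : w ∈ E.tree v) : E.tree w ⊆ E.tree v := by
  obtain ⟨p, hp⟩ := h
  rintro x ⟨q, hq⟩
  exact ⟨p ++ q, hp.append hq⟩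

/-- A path that visits some vertex twice runs through a cycle. -/
theorem exists_isCycleAt_of_not_nodup {u w : V} {p : List A} (h : E.IsPath u p w)
    (hp : ¬ (p.map E.s).Nodup) : ∃ x ∈ E.tree u, ∃ q, E.IsCycleAt x q := by
  induction h with
  | nil => simp at hp
  | @cons e p w h ih =>
    have htree : E.tree (E.r e) ⊆ E.tree (E.s e) := tree_subset_of_mem ⟨[e], .single e⟩
    by_cases hn : (p.map E.s).Nodup
    -- The tail repeats no source, so the repeated one is `E.s e`; the cycle runs from `e` up to the
    -- edge `f` of the tail that starts there again.
    · rw [List.map_cons, List.nodup_cons] at hp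
      obtain ⟨f, hf, hfe⟩ := List.mem_map.1 (by_contra fun h' => hp ⟨h', hn⟩)
      obtain ⟨a, b, rfl⟩ := List.append_of_mem hf
      obtain ⟨x, ha, hb⟩ := h.of_append
      obtain rfl := hb.source_eq
      refine ⟨E.s e, mem_tree_self _, e :: a, List.cons_ne_nil _ _, .cons e (hfe ▸ ha), ?_⟩
      simp only [List.map_append, List.map_cons] at hn
      rw [List.map_cons, List.nodup_cons, ← hfe]
      refine ⟨fun hmem => ?_, hn.of_append_left⟩
      exact (List.disjoint_of_nodup_append hn) hmem (List.mem_cons_self ..)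
    · obtain ⟨x, hx, q, hq⟩ := ih hn
      exact ⟨x, htree hx, q, hq⟩

/-- A closed path of positive length runs through a cycle. -/
theorem exists_isCycleAt_of_closed {v : V} {p : List A} (h : E.IsPath v p v) (hp : p ≠ []) :
    ∃ x ∈ E.tree v, ∃ q, E.IsCycleAt x q := by
  by_cases hn : (p.map E.s).Nodup
  · exact ⟨v, mem_tree_self v, p, hp, h, hn⟩
  · exact exists_isCycleAt_of_not_nodup h hn

end DirGraph

/-! ### Paths as elements of the algebra -/

namespace DirGraph.LeavittPathAlgebra

variable {K : Type*} [Field K] {V A : Type*} {E : DirGraph V A}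

variable (K E) in
/-- The product of the edges of `p`, followed by the vertex `w`: for a path `p` with range `w`, this
is the path as an element of `L_K(E)`. -/
noncomputable def path (p : List A) (w : V) : E.LeavittPathAlgebra K :=
  p.foldr (fun e x => edge K E e * x) (vertex K E w)

theorem path_nil (w : V) : path K E [] w = vertex K E w := rfl

theorem path_cons (e : A) (p : List A) (w : V) :
    path K E (e :: p) w = edge K E e * path K E p w := rfl

theorem path_single (e : A) : path K E [e] (E.r e) = edge K E e := edge_mul_range e

theorem path_mul_vertex (p : List A) (w : V) : path K E p w * vertex K E w = path K E p w := by
  induction p with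
  | nil => exact vertex_mul_self w
  | cons e p ih => rw [path_cons, mul_assoc, ih]

theorem vertex_mul_path {u w : V} {p : List A} (h : E.IsPath u p w) :
    vertex K E u * path K E p w = path K E p w := by
  cases h with
  | nil => exact vertex_mul_self _
  | cons e h => rw [path_cons, ← mul_assoc, source_mul_edge]

theorem vertex_mul_path_of_ne {u v w : V} {p : List A} (h : E.IsPath u p w) (hv : v ≠ u) :
    vertex K E v * path K E p w = 0 := by
  rw [← vertex_mul_path h, ← mul_assoc, vertex_mul_of_ne hv, zero_mul]

theorem path_mul_path {v w : V} (p : List A) {q : List A} (h : E.IsPath v q w) :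
    path K E p v * path K E q w = path K E (p ++ q) w := by
  induction p with
  | nil => exact vertex_mul_path h
  | cons e p ih => rw [path_cons, mul_assoc, ih]; rfl

theorem path_mul_edge (p : List A) (e : A) :
    path K E p (E.s e) * edge K E e = path K E (p ++ [e]) (E.r e) := by
  rw [← path_single, path_mul_path p (.single e)]

theorem star_path_cons (e : A) (p : List A) (w : V) :
    star (path K E (e :: p) w) = star (path K E p w) * ghost K E e := by
  rw [path_cons, star_mul, star_edge]

theorem vertex_mul_star_path (p : List A) (w : V) :
    vertex K E w * star (path K E p w) = star (path K E p w) := by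
  conv_rhs => rw [← path_mul_vertex, star_mul, star_vertex]

theorem star_path_mul_vertex {u w : V} {p : List A} (h : E.IsPath u p w) :
    star (path K E p w) * vertex K E u = star (path K E p w) := by
  conv_rhs => rw [← vertex_mul_path h, star_mul, star_vertex]

theorem star_path_mul_vertex_of_ne {u v w : V} {p : List A} (h : E.IsPath u p w) (hv : u ≠ v) :
    star (path K E p w) * vertex K E v = 0 := by
  rw [← star_path_mul_vertex h, mul_assoc, vertex_mul_of_ne hv, mul_zero]

theorem star_path_mul_path_append {u w w' : V} {p q : List A} (hp : E.IsPath u p w)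
    (hq : E.IsPath w q w') : star (path K E p w) * path K E (p ++ q) w' = path K E q w' := by
  induction hp with
  | nil => rw [path_nil, star_vertex]; exact vertex_mul_path hq
  | cons e hp ih =>
    rw [star_path_cons, List.cons_append, path_cons, mul_assoc, ← mul_assoc (ghost K E e),
      ghost_mul_edge_self, vertex_mul_path (hp.append hq), ih hq]

theorem star_path_mul_path_self {u w : V} {p : List A} (hp : E.IsPath u p w) :
    star (path K E p w) * path K E p w = vertex K E w := by
  simpa [path_nil] using star_path_mul_path_append (K := K) hp (.nil w)

/-- The two paths differ at some position within `p`, where `e* f = 0` applies. The bound on the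
lengths excludes that `q` is a proper initial segment of `p`, which would leave a ghost path. -/
theorem star_path_mul_path_of_not_prefix {u w w' : V} {p q : List A} (hp : E.IsPath u p w)
    (hq : E.IsPath u q w') (hl : p.length ≤ q.length) (h : ¬ p <+: q) :
    star (path K E p w) * path K E q w' = 0 := by
  induction hp generalizing q with
  | nil => exact absurd List.nil_prefix h
  | cons e hp ih =>
    cases q with
    | nil => simp at hl
    | cons f q =>
      rw [star_path_cons, path_cons, mul_assoc, ← mul_assoc (ghost K E e)]
      by_cases hef : e = f
      · subst hef
        rw [ghost_mul_edge_self, vertex_mul_path hq.tail]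
        refine ih hq.tail (by simpa using hl) fun h' => h ?_
        rwa [List.prefix_cons_inj]
      · rw [ghost_mul_edge_of_ne hef, zero_mul, mul_zero]

/-- `L_K(E)` is spanned by the products of a path and a ghost path. -/
theorem mem_span_path_mul_star (x : E.LeavittPathAlgebra K) :
    x ∈ Submodule.span K {y | ∃ u p v q w, E.IsPath u p w ∧ E.IsPath v q w ∧
      y = path K E p w * star (path K E q w)} := by
  set S : Set (E.LeavittPathAlgebra K) := {y | ∃ u p v q w, E.IsPath u p w ∧ E.IsPath v q w ∧
      y = path K E p w * star (path K E q w)} with hS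
  have left : ∀ a : E.LeavittPathAlgebra K, (∀ y ∈ S, a * y ∈ Submodule.span K S) →
      ∀ y ∈ Submodule.span K S, a * y ∈ Submodule.span K S := by
    intro a ha y hy
    induction hy using Submodule.span_induction with
    | mem y hy => exact ha y hy
    | zero => rw [mul_zero]; exact zero_mem _
    | add y z _ _ hy hz => rw [mul_add]; exact add_mem hy hz
    | smul k y _ hy => rw [mul_smul_comm]; exact Submodule.smul_mem _ _ hy
  induction x using generator_induction with
  | zero => exact zero_mem _
  | add x y hx hy => exact add_mem hx hy
  | smul k x hx => exact Submodule.smul_mem _ _ hx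
  | vertex v =>
    refine Submodule.subset_span ⟨v, [], v, [], v, .nil v, .nil v, ?_⟩
    rw [path_nil, star_vertex, vertex_mul_self]
  | edge e =>
    refine Submodule.subset_span ⟨_, [e], _, [], _, .single e, .nil _, ?_⟩
    rw [path_nil, star_vertex, path_mul_vertex, path_single]
  | ghost e =>
    refine Submodule.subset_span ⟨_, [], _, [e], _, .nil _, .single e, ?_⟩
    rw [path_nil, vertex_mul_star_path, path_single, star_edge]
  | vertex_mul v x hx =>
    refine left _ ?_ x hx
    rintro _ ⟨u, p, v', q, w, hp, hq, rfl⟩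
    rw [← mul_assoc]
    by_cases h : v = u
    · subst h
      rw [vertex_mul_path hp]
      exact Submodule.subset_span ⟨_, _, _, _, _, hp, hq, rfl⟩
    · rw [vertex_mul_path_of_ne hp h, zero_mul]; exact zero_mem _
  | edge_mul e x hx =>
    refine left _ ?_ x hx
    rintro _ ⟨u, p, v', q, w, hp, hq, rfl⟩
    rw [← mul_assoc]
    by_cases h : E.r e = u
    · subst h
      exact Submodule.subset_span ⟨_, e :: p, _, _, _, .cons e hp, hq, rfl⟩
    · rw [← edge_mul_range, mul_assoc (edge K E e), vertex_mul_path_of_ne hp h, mul_zero, zero_mul]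
      exact zero_mem _
  | ghost_mul e x hx =>
    refine left _ ?_ x hx
    rintro _ ⟨u, p, v', q, w, hp, hq, rfl⟩
    rw [← mul_assoc]
    cases hp with
    | nil =>
      rw [path_nil]
      by_cases h : E.s e = u
      · subst h
        -- With no real edge left to cancel, the ghost edge joins the ghost path: `e* q* = (q e)*`.
        refine Submodule.subset_span ⟨_, [], _, q ++ [e], _, .nil _, hq.append (.single e), ?_⟩
        rw [ghost_mul_source, path_nil, vertex_mul_star_path, ← path_mul_edge, star_mul, star_edge]
      · rw [ghost_mul_vertex_of_ne h, zero_mul]; exact zero_mem _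
    | @cons f p w hp =>
      rw [path_cons, ← mul_assoc (ghost K E e)]
      by_cases h : e = f
      · subst h
        rw [ghost_mul_edge_self, vertex_mul_path hp]
        exact Submodule.subset_span ⟨_, _, _, _, _, hp, hq, rfl⟩
      · rw [ghost_mul_edge_of_ne h, zero_mul, zero_mul]; exact zero_mem _

/-- A nonzero element of `L_K(E)` does not annihilate all vertices from the left. -/
theorem exists_mul_vertex_ne_zero {x : E.LeavittPathAlgebra K} (hx : x ≠ 0) :
    ∃ v, x * vertex K E v ≠ 0 := by
  classical
  -- Finite sums of vertices are local right units. Allowing every larger `F'` lets two such sets be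
  -- merged in the additive step.
  have key : ∃ F : Finset V, ∀ F', F ⊆ F' → x * ∑ v ∈ F', vertex K E v = x := by
    clear hx
    induction mem_span_path_mul_star x using Submodule.span_induction with
    | mem x h =>
      obtain ⟨u, p, v, q, w, hp, hq, rfl⟩ := h
      refine ⟨{v}, fun F' hF' => ?_⟩
      rw [mul_assoc, Finset.mul_sum, Finset.sum_eq_single v, star_path_mul_vertex hq]
      · exact fun v' _ hv' => star_path_mul_vertex_of_ne hq hv'.symm
      · exact fun h => absurd (hF' (Finset.mem_singleton_self v)) h
    | zero => exact ⟨∅, fun _ _ => zero_mul _⟩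
    | add x y _ _ ihx ihy =>
      obtain ⟨F, hF⟩ := ihx
      obtain ⟨G, hG⟩ := ihy
      refine ⟨F ∪ G, fun F' hF' => ?_⟩
      rw [add_mul, hF F' (Finset.union_subset_left hF'), hG F' (Finset.union_subset_right hF')]
    | smul k x _ ih =>
      obtain ⟨F, hF⟩ := ih
      exact ⟨F, fun F' hF' => by rw [smul_mul_assoc, hF F' hF']⟩
  obtain ⟨F, hF⟩ := key
  by_contra! h
  refine hx ?_
  rw [← hF F subset_rfl, Finset.mul_sum]
  exact Finset.sum_eq_zero fun v _ => h v

end DirGraph.LeavittPathAlgebra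

/-! ### Periodic words -/

/-- If `γ` is a nonempty list, then a list that is an initial segment of its translate by `γ` is
determined by its length. -/
theorem List.eq_of_prefix_append {α : Type*} {γ : List α} (hγ : γ ≠ []) {l : List α} {a b : α}
    (ha : l ++ [a] <+: γ ++ (l ++ [a])) (hb : l ++ [b] <+: γ ++ (l ++ [b])) : a = b := by
  induction hn : l.length using Nat.strong_induction_on generalizing l with
  | _ n ih =>
    by_cases hl : (l ++ [a]).length ≤ γ.length
    · have h₁ := List.prefix_of_prefix_length_le ha (List.prefix_append γ _) hl
      have h₂ := List.prefix_of_prefix_length_le hb (List.prefix_append γ _) (by simpa using hl)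
      have := (List.prefix_of_prefix_length_le h₁ h₂ (by simp)).eq_of_length (by simp)
      simpa using this
    -- Both words begin with `γ`; cancelling it leaves the same situation for a shorter list.
    · have hl' : γ.length ≤ l.length := by simp at hl; omega
      have h₁ : γ <+: l := List.prefix_of_prefix_length_le (List.prefix_append γ _)
        ((List.prefix_append l [a]).trans ha) hl'
      obtain ⟨m, rfl⟩ := h₁
      rw [List.append_assoc, List.prefix_append_right_inj] at ha hb
      refine ih m.length ?_ ha hb rfl
      have := List.length_pos_of_ne_nil hγ
      simp at hn; omega

/-! ### A representation over the Laurent polynomials -/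

namespace DirGraph

open LaurentPolynomial

variable {V A : Type*}

/-- A coding of `E`: every set `{v} × ℕ` with `v` not a sink is partitioned into copies of the sets
`{r(e)} × ℕ` with `s(e) = v`. -/
structure Coding (E : DirGraph V A) where
  /-- The embedding of `{r(e)} × ℕ` into `{s(e)} × ℕ`. -/
  enc : A → ℕ → ℕ
  /-- The edge and the preimage to which a point of `{v} × ℕ` belongs. -/
  dec : V → ℕ → Option (A × ℕ)
  source_of_dec : ∀ {v k e l}, dec v k = some (e, l) → E.s e = v ∧ enc e l = k
  dec_enc : ∀ e l, dec (E.s e) (enc e l) = some (e, l)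
  dec_ne_none : ∀ e k, dec (E.s e) k ≠ none

/-- If `v` is not a sink, the set of pairs of an edge from `v` and a natural number is countably
infinite, so any bijection with `ℕ` will do. Countability of the edges enters the theorem only here.
-/
theorem exists_coding [Countable A] (E : DirGraph V A) : Nonempty E.Coding := by
  classical
  have h : ∀ v, Nonempty {e // E.s e = v} → Nonempty (({e // E.s e = v} × ℕ) ≃ ℕ) := by
    intro v hv
    obtain ⟨_⟩ := nonempty_denumerable ({e // E.s e = v} × ℕ)
    exact ⟨Denumerable.eqv _⟩
  have θ := fun v hv => (h v hv).some
  -- The bijection depends on the vertex; this transports it along `E.s e = v`.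
  have aux : ∀ v (e : A) (he : E.s e = v) l (hv : Nonempty {e // E.s e = v})
      (hv' : Nonempty {f // E.s f = E.s e}),
      θ (E.s e) hv' (⟨e, rfl⟩, l) = θ v hv (⟨e, he⟩, l) := by
    rintro _ e rfl l _ _; rfl
  refine ⟨{
    enc := fun e l => θ (E.s e) ⟨e, rfl⟩ (⟨e, rfl⟩, l)
    dec := fun v k => if hv : Nonempty {e // E.s e = v} then
      some (((θ v hv).symm k).1.1, ((θ v hv).symm k).2) else none
    source_of_dec := ?_
    dec_enc := ?_
    dec_ne_none := ?_ }⟩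
  · intro v k e l hd
    split_ifs at hd with hv
    obtain ⟨rfl, rfl⟩ := Prod.mk.inj (Option.some.inj hd)
    have hs := ((θ v hv).symm k).1.2
    exact ⟨hs, by rw [aux v _ hs _ hv]; exact (θ v hv).apply_symm_apply k⟩
  · intro e l
    have hv : Nonempty {f // E.s f = E.s e} := ⟨e, rfl⟩
    rw [dif_pos hv, Equiv.symm_apply_apply]
  · intro e k
    have hv : Nonempty {f // E.s f = E.s e} := ⟨e, rfl⟩
    rw [dif_pos hv]
    exact Option.some_ne_none _

namespace Coding

variable (K : Type*) [Field K] {E : DirGraph V A} (c : E.Coding)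

/-- The module of all functions on `V × ℕ` with values in the Laurent polynomials. -/
abbrev Functions (K V : Type*) [Field K] : Type _ := V × ℕ → K[T;T⁻¹]

open Classical in
/-- The action of a vertex. -/
noncomputable def vertexOp (v : V) : Module.End K[T;T⁻¹] (Functions K V) where
  toFun f x := if x.1 = v then f x else 0
  map_add' f g := by ext1 x; simp only [Pi.add_apply]; split_ifs <;> simp
  map_smul' a f := by ext1 x; simp

open Classical in
/-- The action of an edge. -/
noncomputable def edgeOp (e : A) : Module.End K[T;T⁻¹] (Functions K V) where
  toFun f x := (c.dec x.1 x.2).elim 0 fun y => if y.1 = e then T 1 * f (E.r e, y.2) else 0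
  map_add' f g := by
    ext1 x
    cases h : c.dec x.1 x.2 with
    | none => simp [h]
    | some y => simp only [h, Pi.add_apply, Option.elim]; split_ifs <;> simp [mul_add]
  map_smul' a f := by
    ext1 x
    cases h : c.dec x.1 x.2 with
    | none => simp [h]
    | some y => simp [h, mul_left_comm]

open Classical in
/-- The action of a ghost edge. -/
noncomputable def ghostOp (e : A) : Module.End K[T;T⁻¹] (Functions K V) where
  toFun f x := if x.1 = E.r e then T (-1) * f (E.s e, c.enc e x.2) else 0
  map_add' f g := by ext1 x; simp only [Pi.add_apply]; split_ifs <;> simp [mul_add]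
  map_smul' a f := by ext1 x; simp [mul_left_comm]

variable {K}

open Classical in
theorem vertexOp_apply (v : V) (f : Functions K V) (x : V × ℕ) :
    vertexOp K v f x = if x.1 = v then f x else 0 := rfl

open Classical in
theorem ghostOp_apply (e : A) (f : Functions K V) (x : V × ℕ) :
    c.ghostOp K e f x = if x.1 = E.r e then T (-1) * f (E.s e, c.enc e x.2) else 0 := rfl

theorem edgeOp_of_none (e : A) (f : Functions K V) {x : V × ℕ} (h : c.dec x.1 x.2 = none) :
    c.edgeOp K e f x = 0 := by
  simp [edgeOp, h]

open Classical in
theorem edgeOp_of_some (e : A) (f : Functions K V) {x : V × ℕ} {e' : A} {l : ℕ}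
    (h : c.dec x.1 x.2 = some (e', l)) :
    c.edgeOp K e f x = if e' = e then T 1 * f (E.r e, l) else 0 := by
  simp [edgeOp, h]

theorem T_mul_T_neg : (T 1 * T (-1) : K[T;T⁻¹]) = 1 := by
  rw [← T_add, add_neg_cancel, T_zero]

theorem T_neg_mul_T : (T (-1) * T 1 : K[T;T⁻¹]) = 1 := by
  rw [← T_add, neg_add_cancel, T_zero]

variable (K)

/-- The representation of `L_K(E)` on functions that is given by a coding. -/
noncomputable def rep : E.LeavittPathAlgebra K →ₙₐ[K] Module.End K[T;T⁻¹] (Functions K V) :=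
  LeavittPathAlgebra.lift (LeavittPathAlgebra.letterMap (vertexOp K) (c.edgeOp K) (c.ghostOp K)) <| by
    classical
    apply LeavittPathAlgebra.freeLift_eq_of_rel
    · intro v; ext f x : 2
      simp only [Module.End.mul_apply, vertexOp_apply]; split_ifs <;> rfl
    · intro v w h; ext f x : 2
      simp only [Module.End.mul_apply, vertexOp_apply]
      split_ifs with h₁ h₂
      · exact absurd (h₁.symm.trans h₂) h
      · rfl
      · rfl
    · intro e; ext f x : 2
      rw [Module.End.mul_apply, vertexOp_apply]
      cases h : c.dec x.1 x.2 with
      | none => simp [c.edgeOp_of_none e f h]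
      | some y =>
        rw [c.edgeOp_of_some e f h]
        have := (c.source_of_dec h).1
        split_ifs with h₁ h₂ h₃
        · rfl
        · rfl
        · exact absurd (h₃ ▸ this.symm) h₁
        · rfl
    · intro e; ext f x : 2
      rw [Module.End.mul_apply]
      cases h : c.dec x.1 x.2 with
      | none => simp [c.edgeOp_of_none e _ h]
      | some y => rw [c.edgeOp_of_some e _ h, c.edgeOp_of_some e _ h, vertexOp_apply, if_pos rfl]
    · intro e; ext f x : 2
      simp only [Module.End.mul_apply, vertexOp_apply, ghostOp_apply]; split_ifs <;> rfl
    · intro e; ext f x : 2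
      simp only [Module.End.mul_apply, vertexOp_apply, ghostOp_apply, if_true]
    · intro e; ext f x : 2
      rw [Module.End.mul_apply, ghostOp_apply, vertexOp_apply, c.edgeOp_of_some e f (c.dec_enc e _),
        if_pos rfl, ← mul_assoc, T_neg_mul_T, one_mul]
      split_ifs with h
      · rw [← h]
      · rfl
    · intro e f' h; ext f x : 2
      rw [Module.End.mul_apply, ghostOp_apply, c.edgeOp_of_some f' f (c.dec_enc e _), if_neg h,
        mul_zero, ite_self]; rfl
    · intro v h; ext f x : 2
      rw [LinearMap.sum_apply, Finset.sum_apply]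
      simp only [Module.End.mul_apply]
      -- Only the edge to which the point `x` is decoded contributes to the sum of the `e e*`, with
      -- factor `T * T⁻¹ = 1`. A point without such an edge lies over a sink, which is not regular.
      cases hd : c.dec x.1 x.2 with
      | none =>
        rw [Finset.sum_eq_zero fun e _ => c.edgeOp_of_none e _ hd, vertexOp_apply, if_neg]
        rintro rfl
        obtain ⟨e, he⟩ := h.2
        rw [← show E.s e = x.1 from he] at hd
        exact c.dec_ne_none e _ hd
      | some y =>
        obtain ⟨e', l⟩ := y
        obtain ⟨hs, hl⟩ := c.source_of_dec hd
        rw [Finset.sum_congr rfl fun e _ => c.edgeOp_of_some e _ hd, Finset.sum_ite_eq,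
          ghostOp_apply, if_pos rfl, ← mul_assoc, T_mul_T_neg, one_mul, vertexOp_apply]
        simp only [hs, hl, Set.Finite.mem_toFinset, Set.mem_ofPred_eq]

open LeavittPathAlgebra

theorem rep_vertex (v : V) : c.rep K (vertex K E v) = vertexOp K v := lift_vertex v
theorem rep_edge (e : A) : c.rep K (edge K E e) = c.edgeOp K e := lift_edge e
theorem rep_ghost (e : A) : c.rep K (ghost K E e) = c.ghostOp K e := lift_ghost e

open Classical in
/-- The indicator function of `{v} × ℕ`. -/
noncomputable def indicator (v : V) : Functions K V := fun x => if x.1 = v then 1 else 0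

variable {K}

theorem smul_indicator_inj {v : V} {a b : K[T;T⁻¹]}
    (h : a • indicator K v = b • indicator K v) : a = b := by
  simpa [indicator] using congrFun h (v, 0)

theorem rep_vertex_indicator (v : V) :
    c.rep K (vertex K E v) (indicator K v) = indicator K v := by
  ext1 x
  rw [rep_vertex, vertexOp_apply]; simp [indicator]

/-- Without a second edge at `s(e)`, the set `{s(e)} × ℕ` is a single copy of `{r(e)} × ℕ`, so `e`
carries one indicator function to the other, up to `T`. -/
theorem rep_edge_indicator {e : A} (h : ¬ E.IsBifurcation (E.s e)) :
    c.rep K (edge K E e) (indicator K (E.r e)) = (T 1 : K[T;T⁻¹]) • indicator K (E.s e) := by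
  ext1 x
  rw [rep_edge, Pi.smul_apply, indicator]
  cases hd : c.dec x.1 x.2 with
  | none =>
    rw [c.edgeOp_of_none _ _ hd, if_neg, smul_zero]
    intro hx
    rw [hx] at hd
    exact c.dec_ne_none e _ hd
  | some y =>
    obtain ⟨e', l⟩ := y
    rw [c.edgeOp_of_some _ _ hd, ← (c.source_of_dec hd).1]
    by_cases he : e' = e
    · subst he; simp [indicator]
    · rw [if_neg he, if_neg, smul_zero]
      exact fun hs => h ⟨e', hs, e, rfl, he⟩

theorem rep_ghost_indicator (e : A) :
    c.rep K (ghost K E e) (indicator K (E.s e)) =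
      (T (-1) : K[T;T⁻¹]) • indicator K (E.r e) := by
  ext1 x
  rw [rep_ghost, ghostOp_apply, Pi.smul_apply, indicator, indicator]
  simp

theorem rep_path_indicator {u w : V} {p : List A} (hp : E.IsPath u p w)
    (h : ∀ x ∈ E.tree u, ¬ E.IsBifurcation x) :
    c.rep K (path K E p w) (indicator K w) = (T p.length : K[T;T⁻¹]) • indicator K u := by
  induction hp with
  | nil => simp [path_nil, rep_vertex_indicator]
  | @cons e p w hp ih =>
    rw [path_cons, map_mul, Module.End.mul_apply,
      ih fun x hx => h x (tree_subset_of_mem ⟨[e], .single e⟩ hx), map_smul,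
      c.rep_edge_indicator (h _ (mem_tree_self _)), smul_smul, ← T_add, List.length_cons]
    simp

theorem rep_star_path_indicator {u w : V} {p : List A} (hp : E.IsPath u p w) :
    c.rep K (star (path K E p w)) (indicator K u) =
      (T (-p.length) : K[T;T⁻¹]) • indicator K w := by
  induction hp with
  | nil => simp [path_nil, star_vertex, rep_vertex_indicator]
  | @cons e p w hp ih =>
    rw [star_path_cons, map_mul, Module.End.mul_apply, rep_ghost_indicator, map_smul, ih,
      smul_smul, ← T_add, List.length_cons, Nat.cast_add, neg_add_rev, Nat.cast_one]

/-- If there are no bifurcations in the tree of `v`, then the corner of `L_K(E)` at `v` acts on the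
indicator function of `{v} × ℕ` by scalars. -/
theorem exists_rep_indicator {v : V} (h : ∀ x ∈ E.tree v, ¬ E.IsBifurcation x)
    (y : E.LeavittPathAlgebra K) :
    ∃ a : K[T;T⁻¹], c.rep K (vertex K E v * y * vertex K E v) (indicator K v) =
      a • indicator K v := by
  induction mem_span_path_mul_star y using Submodule.span_induction with
  | mem y hy =>
    obtain ⟨u, p, u', q, w, hp, hq, rfl⟩ := hy
    by_cases hu : v = u
    · by_cases hu' : u' = v
      · subst hu hu'
        rw [← mul_assoc, vertex_mul_path hp, mul_assoc, star_path_mul_vertex hq, map_mul,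
          Module.End.mul_apply, rep_star_path_indicator c hq, map_smul, c.rep_path_indicator hp h,
          smul_smul]
        exact ⟨_, rfl⟩
      · rw [mul_assoc, mul_assoc, star_path_mul_vertex_of_ne hq hu']
        exact ⟨0, by simp⟩
    · rw [← mul_assoc, vertex_mul_path_of_ne hp hu]
      exact ⟨0, by simp⟩
  | zero => exact ⟨0, by simp⟩
  | add y z _ _ hy hz =>
    obtain ⟨a, ha⟩ := hy
    obtain ⟨b, hb⟩ := hz
    exact ⟨a + b, by rw [mul_add, add_mul, map_add, LinearMap.add_apply, ha, hb, add_smul]⟩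
  | smul k y _ hy =>
    obtain ⟨a, ha⟩ := hy
    exact ⟨k • a, by
      rw [mul_smul_comm, smul_mul_assoc, map_smul, LinearMap.smul_apply, ha, smul_assoc]⟩

end Coding

open LeavittPathAlgebra in
-- In the representation the vertex fixes its own indicator function, which is not zero.
theorem LeavittPathAlgebra.vertex_ne_zero (K : Type*) [Field K] [Countable A] (E : DirGraph V A)
    (v : V) : vertex K E v ≠ 0 := by
  obtain ⟨c⟩ := E.exists_coding
  intro h
  have h₁ := c.rep_vertex_indicator (K := K) v
  rw [h, map_zero, LinearMap.zero_apply] at h₁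
  exact zero_ne_one (Coding.smul_indicator_inj (by rw [zero_smul, one_smul]; exact h₁))

/-- Evaluation at `T = 1` sends the left side to `0`. -/
theorem Coding.one_sub_T_mul_ne_one {K : Type*} [Field K] (n : ℤ) (a : K[T;T⁻¹]) :
    a * (1 - T n) ≠ 1 := by
  intro h
  have := congrArg (LaurentPolynomial.eval₂ (RingHom.id K) 1) h
  simp at this

end DirGraph

/-! ### Reduction of nonzero elements to a corner -/

namespace DirGraph.LeavittPathAlgebra

variable {K : Type*} [Field K] {V A : Type*} {E : DirGraph V A}

/-- The element `x` can be turned, by multiplication from both sides, into a polynomial in closed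
paths at some vertex `v` with nonzero constant term; the polynomial is constant unless there are no
bifurcations in the tree of `v`. -/
def HasCornerReduction (x : E.LeavittPathAlgebra K) : Prop :=
  ∃ (v : V) (a b : E.LeavittPathAlgebra K) (k : K) (s : Finset (List A)) (γ : List A → List A)
    (c : List A → K), k ≠ 0 ∧ vertex K E v * a = a ∧
      (∀ i ∈ s, γ i ≠ [] ∧ E.IsPath v (γ i) v) ∧
      (s = ∅ ∨ ∀ w ∈ E.tree v, ¬ E.IsBifurcation w) ∧
      a * x * b = k • vertex K E v + ∑ i ∈ s, c i • path K E (γ i) v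

theorem HasCornerReduction.of_mul_mul {a x b : E.LeavittPathAlgebra K}
    (h : HasCornerReduction (a * x * b)) : HasCornerReduction x := by
  obtain ⟨v, a', b', k, s, γ, c, hk, ha, hγ, hs, h⟩ := h
  refine ⟨v, a' * a, b * b', k, s, γ, c, hk, by rw [← mul_assoc, ha], hγ, hs, ?_⟩
  rw [← h]; simp only [mul_assoc]

open Classical in
/-- Multiplication of a combination of paths by a ghost path that is at most as long as each. -/
theorem star_path_mul_sum {ι : Type*} {u w w' : V} {p : List A} (hp : E.IsPath u p w)
    (s : Finset ι) (ρ : ι → List A) (c : ι → K) (hρ : ∀ i ∈ s, E.IsPath u (ρ i) w')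
    (hl : ∀ i ∈ s, p.length ≤ (ρ i).length) :
    star (path K E p w) * ∑ i ∈ s, c i • path K E (ρ i) w' =
      ∑ i ∈ s with p <+: ρ i, c i • path K E ((ρ i).drop p.length) w' := by
  rw [Finset.mul_sum, Finset.sum_filter]
  refine Finset.sum_congr rfl fun i hi => ?_
  rw [mul_smul_comm]
  split_ifs with h
  · obtain ⟨t, ht⟩ := h
    have := hρ i hi
    rw [← ht] at this ⊢
    rw [star_path_mul_path_append hp (hp.of_append_right this), List.drop_left]
  · rw [star_path_mul_path_of_not_prefix hp (hρ i hi) (hl i hi) h, smul_zero]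

theorem vertex_mul_smul_vertex_mul (v : V) (k : K) :
    vertex K E v * (k • vertex K E v) * vertex K E v = k • vertex K E v := by
  rw [mul_smul_comm, smul_mul_assoc, vertex_mul_self, vertex_mul_self]

/-- Induction on the number of terms. Suppose `p` leads from `v` to a bifurcation, and put `q = p g`
for an edge `g` there. Compression to `q* (·) q` turns `k v` into `k r(g)` and keeps the term of `γ`
only if `q` is an initial segment of `γ q`. By `List.eq_of_prefix_append` this holds for at most one
`g`, so another choice removes a given term. The terms are counted by their indices, so coincidences
among the paths do no harm. -/
theorem hasCornerReduction_of_closed {v : V} {k : K} (hk : k ≠ 0) (s : Finset (List A))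
    (γ : List A → List A) (c : List A → K) (hγ : ∀ i ∈ s, γ i ≠ [] ∧ E.IsPath v (γ i) v) :
    HasCornerReduction (k • vertex K E v + ∑ i ∈ s, c i • path K E (γ i) v) := by
  classical
  induction hn : s.card using Nat.strong_induction_on generalizing v s γ with
  | _ n ih =>
    by_cases hb : s = ∅ ∨ ∀ w ∈ E.tree v, ¬ E.IsBifurcation w
    · refine ⟨v, vertex K E v, vertex K E v, k, s, γ, c, hk, vertex_mul_self v, hγ, hb, ?_⟩
      rw [mul_add, add_mul, vertex_mul_smul_vertex_mul, Finset.mul_sum, Finset.sum_mul]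
      congr 1
      refine Finset.sum_congr rfl fun i hi => ?_
      rw [mul_smul_comm, smul_mul_assoc, vertex_mul_path (hγ i hi).2, path_mul_vertex]
    · push Not at hb
      obtain ⟨hs, w, ⟨p, hp⟩, e, he, f, hf, hef⟩ := hb
      obtain ⟨i, hi⟩ := hs
      have : ∃ g, E.s g = w ∧ ¬ p ++ [g] <+: γ i ++ (p ++ [g]) := by
        by_contra! h
        exact hef (List.eq_of_prefix_append (hγ i hi).1 (h e he) (h f hf))
      obtain ⟨g, rfl, hg⟩ := this
      have hq : E.IsPath v (p ++ [g]) (E.r g) := hp.append (.single g)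
      set q := p ++ [g]
      refine HasCornerReduction.of_mul_mul (a := star (path K E q (E.r g)))
        (b := path K E q (E.r g)) ?_
      have key : star (path K E q (E.r g)) * (k • vertex K E v + ∑ i ∈ s, c i • path K E (γ i) v) *
          path K E q (E.r g) = k • vertex K E (E.r g) +
          ∑ i ∈ s with q <+: γ i ++ q, c i • path K E ((γ i ++ q).drop q.length) (E.r g) := by
        rw [← star_path_mul_sum hq s _ c (fun i hi => (hγ i hi).2.append hq) (by simp), mul_assoc,
          add_mul, mul_add, smul_mul_assoc, vertex_mul_path hq, mul_smul_comm,
          star_path_mul_path_self hq, Finset.sum_mul]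
        congr 2
        refine Finset.sum_congr rfl fun i _ => ?_
        rw [smul_mul_assoc, path_mul_path _ hq]
      rw [key]
      refine ih _ ?_ _ (fun i => (γ i ++ q).drop q.length) ?_ rfl
      · rw [← hn]
        exact Finset.card_lt_card (Finset.filter_ssubset.2 ⟨i, hi, hg⟩)
      · intro i hi
        obtain ⟨hi, t, ht⟩ := Finset.mem_filter.1 hi
        have hpath := (hγ i hi).2.append hq
        rw [← ht] at hpath ⊢
        rw [List.drop_left]
        -- The new closed path is as long as `γ i`, hence nonempty.
        refine ⟨?_, hq.of_append_right hpath⟩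
        rintro rfl
        have hlen := congrArg List.length ht
        rw [List.append_nil, List.length_append (as := γ i) (bs := q)] at hlen
        have := List.length_pos_of_ne_nil (hγ i hi).1
        omega

/-- A nonzero combination of paths from `u` to `v` is turned into a combination of closed paths with
nonzero constant term by multiplication with a ghost path. -/
theorem exists_star_path_mul_eq {u v : V} {l : List A →₀ K} (hl : l ≠ 0)
    (hp : ∀ p ∈ l.support, E.IsPath u p v) :
    ∃ (a : E.LeavittPathAlgebra K) (k : K) (s : Finset (List A)) (γ : List A → List A), k ≠ 0 ∧
      (∀ i ∈ s, γ i ≠ [] ∧ E.IsPath v (γ i) v) ∧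
      a * Finsupp.linearCombination K (path K E · v) l =
        k • vertex K E v + ∑ i ∈ s, l i • path K E (γ i) v := by
  classical
  -- For a shortest path `p` of the support, `p*` turns `p` into `v` and any other path either into
  -- a closed path at `v` of positive length or into zero.
  obtain ⟨p, hps, hmin⟩ := l.support.exists_min_image List.length
    (Finsupp.support_nonempty_iff.2 hl)
  have hpath := hp p hps
  refine ⟨star (path K E p v), l p, {q ∈ l.support.erase p | p <+: q},
    fun q => q.drop p.length, Finsupp.mem_support_iff.1 hps, ?_, ?_⟩
  · intro q hq
    obtain ⟨hq, t, rfl⟩ := Finset.mem_filter.1 hq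
    obtain ⟨hne, hq⟩ := Finset.mem_erase.1 hq
    simp only [List.drop_left]
    refine ⟨?_, hpath.of_append_right (hp _ hq)⟩
    rintro rfl
    exact hne (List.append_nil p)
  · rw [Finsupp.linearCombination_apply, Finsupp.sum, ← Finset.add_sum_erase _ _ hps, mul_add,
      mul_smul_comm, star_path_mul_path_self hpath, star_path_mul_sum hpath]
    · exact fun i hi => hp i (Finset.mem_of_mem_erase hi)
    · exact fun i hi => hmin i (Finset.mem_of_mem_erase hi)

variable (K E) in
/-- The span of the products of a path with source `u` and a ghost path with range `v` and length at
most `n`. -/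
noncomputable def ghostBounded (n : ℕ) (u v : V) : Submodule K (E.LeavittPathAlgebra K) :=
  Submodule.span K {x | ∃ p q w, E.IsPath u p w ∧ E.IsPath v q w ∧ q.length ≤ n ∧
    x = path K E p w * star (path K E q w)}

theorem ghostBounded_mono {m n : ℕ} (h : m ≤ n) (u v : V) :
    ghostBounded K E m u v ≤ ghostBounded K E n u v :=
  Submodule.span_mono fun _ ⟨p, q, w, hp, hq, hm, hx⟩ => ⟨p, q, w, hp, hq, hm.trans h, hx⟩

theorem exists_mem_ghostBounded (u v : V) (x : E.LeavittPathAlgebra K) :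
    ∃ n, vertex K E u * x * vertex K E v ∈ ghostBounded K E n u v := by
  induction mem_span_path_mul_star x using Submodule.span_induction with
  | mem x hx =>
    obtain ⟨u', p, v', q, w, hp, hq, rfl⟩ := hx
    refine ⟨q.length, ?_⟩
    rw [← mul_assoc, mul_assoc]
    by_cases hu : u = u'
    · by_cases hv : v' = v
      · subst hu hv
        rw [vertex_mul_path hp, star_path_mul_vertex hq]
        exact Submodule.subset_span ⟨p, q, w, hp, hq, le_rfl, rfl⟩
      · rw [star_path_mul_vertex_of_ne hq hv, mul_zero]; exact zero_mem _
    · rw [vertex_mul_path_of_ne hp hu, zero_mul]; exact zero_mem _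
  | zero => exact ⟨0, by simp⟩
  | add x y _ _ hx hy =>
    obtain ⟨m, hm⟩ := hx
    obtain ⟨n, hn⟩ := hy
    refine ⟨max m n, ?_⟩
    rw [mul_add, add_mul]
    exact add_mem (ghostBounded_mono (le_max_left m n) _ _ hm)
      (ghostBounded_mono (le_max_right m n) _ _ hn)
  | smul k x _ hx =>
    obtain ⟨n, hn⟩ := hx
    exact ⟨n, by rw [mul_smul_comm, smul_mul_assoc]; exact Submodule.smul_mem _ _ hn⟩

theorem ghostBounded_mul_vertex {n : ℕ} {u v : V} {x : E.LeavittPathAlgebra K}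
    (hx : x ∈ ghostBounded K E n u v) : x * vertex K E v = x := by
  induction hx using Submodule.span_induction with
  | mem x hx =>
    obtain ⟨p, q, w, hp, hq, _, rfl⟩ := hx
    rw [mul_assoc, star_path_mul_vertex hq]
  | zero => exact zero_mul _
  | add x y _ _ hx hy => rw [add_mul, hx, hy]
  | smul k x _ hx => rw [smul_mul_assoc, hx]

/-- The edge meets the ghost of the first edge of `q`: it cancels it or gives zero. If `q` is empty,
it prolongs `p` instead. -/
theorem ghostBounded_mul_edge {n : ℕ} {u : V} (e : A) {x : E.LeavittPathAlgebra K}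
    (hx : x ∈ ghostBounded K E (n + 1) u (E.s e)) :
    x * edge K E e ∈ ghostBounded K E n u (E.r e) := by
  induction hx using Submodule.span_induction with
  | mem x hx =>
    obtain ⟨p, q, w, hp, hq, hn, rfl⟩ := hx
    cases q with
    | nil =>
      obtain rfl := hq.eq_of_nil
      refine Submodule.subset_span ⟨p ++ [e], [], E.r e, hp.append (.single e), .nil _,
        Nat.zero_le n, ?_⟩
      rw [path_nil, path_nil, star_vertex, star_vertex, path_mul_vertex, path_mul_vertex,
        path_mul_edge]
    | cons f q =>
      rw [star_path_cons, mul_assoc, mul_assoc]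
      by_cases h : f = e
      · subst h
        rw [ghost_mul_edge_self, star_path_mul_vertex hq.tail]
        exact Submodule.subset_span ⟨p, q, w, hp, hq.tail, by simpa using hn, rfl⟩
      · rw [ghost_mul_edge_of_ne h, mul_zero, mul_zero]; exact zero_mem _
  | zero => rw [zero_mul]; exact zero_mem _
  | add x y _ _ hx hy => rw [add_mul]; exact add_mem hx hy
  | smul k x _ hx => rw [smul_mul_assoc]; exact Submodule.smul_mem _ _ hx

/-- The elements without ghost edges are the combinations of paths. -/
theorem exists_linearCombination_of_mem_ghostBounded_zero {u v : V} {x : E.LeavittPathAlgebra K}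
    (hx : x ∈ ghostBounded K E 0 u v) :
    ∃ l : List A →₀ K, (∀ p ∈ l.support, E.IsPath u p v) ∧
      Finsupp.linearCombination K (path K E · v) l = x := by
  have hx' : x ∈ Submodule.span K ((path K E · v) '' {p | E.IsPath u p v}) := by
    refine Submodule.span_mono ?_ hx
    rintro _ ⟨p, q, w, hp, hq, hn, rfl⟩
    obtain rfl := List.eq_nil_of_length_eq_zero (Nat.le_zero.1 hn)
    obtain rfl := hq.eq_of_nil
    exact ⟨p, hp, by rw [path_nil, star_vertex, path_mul_vertex]⟩
  obtain ⟨l, hl, rfl⟩ := (Finsupp.mem_span_image_iff_linearCombination K).1 hx'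
  exact ⟨l, fun p hp => hl hp, rfl⟩

/-- Separation of the terms with and without ghost edges. -/
theorem exists_eq_linearCombination_add {n : ℕ} {u v : V} {x : E.LeavittPathAlgebra K}
    (hx : x ∈ ghostBounded K E n u v) :
    ∃ (l : List A →₀ K) (z : E.LeavittPathAlgebra K) (F : Finset A),
      (∀ p ∈ l.support, E.IsPath u p v) ∧
      (∀ F', F ⊆ F' → z * ∑ e ∈ F', edge K E e * ghost K E e = z) ∧
      x = Finsupp.linearCombination K (path K E · v) l + z := by
  classical
  induction hx using Submodule.span_induction with
  | mem x hx =>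
    obtain ⟨p, q, w, hp, hq, hn, rfl⟩ := hx
    cases q with
    | nil =>
      obtain rfl := hq.eq_of_nil
      refine ⟨Finsupp.single p 1, 0, ∅, ?_, by simp, ?_⟩
      · intro p' hp'
        obtain rfl := Finset.mem_singleton.1 (Finsupp.support_single_subset hp')
        exact hp
      · rw [path_nil, star_vertex, path_mul_vertex]; simp
    | cons e q =>
      refine ⟨0, _, {e}, by simp, fun F' hF' => ?_, by rw [map_zero, zero_add]⟩
      -- A product ending in `e*` is fixed by `e e*` and killed by `f f*` for `f ≠ e`.
      rw [star_path_cons, mul_assoc, mul_assoc, Finset.mul_sum, Finset.sum_eq_single e,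
        ← mul_assoc (ghost K E e), ghost_mul_edge_self, range_mul_ghost]
      · intro f _ hf
        rw [← mul_assoc, ghost_mul_edge_of_ne hf.symm, zero_mul]
      · exact fun h => absurd (hF' (Finset.mem_singleton_self e)) h
  | zero => exact ⟨0, 0, ∅, by simp, by simp, by simp⟩
  | add x y _ _ hx hy =>
    obtain ⟨l, z, F, hl, hz, rfl⟩ := hx
    obtain ⟨l', z', F', hl', hz', rfl⟩ := hy
    refine ⟨l + l', z + z', F ∪ F', fun p hp => ?_, fun G hG => ?_, ?_⟩
    · exact (Finset.mem_union.1 (Finsupp.support_add hp)).elim (hl p) (hl' p)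
    · rw [add_mul, hz G (Finset.union_subset_left hG), hz' G (Finset.union_subset_right hG)]
    · rw [map_add]; abel
  | smul k x _ hx =>
    obtain ⟨l, z, F, hl, hz, rfl⟩ := hx
    refine ⟨k • l, k • z, F, fun p hp => hl p (Finsupp.support_smul hp), fun G hG => ?_, ?_⟩
    · rw [smul_mul_assoc, hz G hG]
    · rw [map_smul, smul_add]

theorem hasCornerReduction_linearCombination {u v : V} {l : List A →₀ K} (hl : l ≠ 0)
    (hp : ∀ p ∈ l.support, E.IsPath u p v) :
    HasCornerReduction (Finsupp.linearCombination K (path K E · v) l) := by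
  obtain ⟨a, k, s, γ, hk, hγ, h⟩ := exists_star_path_mul_eq (K := K) hl hp
  refine HasCornerReduction.of_mul_mul (a := a) (b := vertex K E v) ?_
  rw [h, add_mul, smul_mul_assoc, vertex_mul_self, Finset.sum_mul]
  simp only [smul_mul_assoc, path_mul_vertex]
  exact hasCornerReduction_of_closed hk s γ _ hγ

/-- Induction on the ghost length. If `x e ≠ 0` for some edge `e`, the length drops. Otherwise `x`
kills all edges, and `v` decides: at a sink the part with ghost edges vanishes; at a regular vertex
`x = ∑ x e e* = 0`; at an infinite emitter a fresh edge isolates the constant term. -/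
theorem hasCornerReduction_of_mem_ghostBounded {n : ℕ} {u v : V} {x : E.LeavittPathAlgebra K}
    (hx : x ∈ ghostBounded K E n u v) (h0 : x ≠ 0) : HasCornerReduction x := by
  classical
  induction n generalizing v x with
  | zero =>
    obtain ⟨l, hl, rfl⟩ := exists_linearCombination_of_mem_ghostBounded_zero hx
    refine hasCornerReduction_linearCombination ?_ hl
    rintro rfl
    exact h0 (map_zero _)
  | succ n ih =>
    by_cases he : ∃ e, E.s e = v ∧ x * edge K E e ≠ 0
    · obtain ⟨e, rfl, he⟩ := he
      refine HasCornerReduction.of_mul_mul (a := vertex K E u) (b := edge K E e) ?_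
      have hux : vertex K E u * x = x := by
        clear h0 he
        induction hx using Submodule.span_induction with
        | mem x hx =>
          obtain ⟨p, q, w, hp, hq, _, rfl⟩ := hx
          rw [← mul_assoc, vertex_mul_path hp]
        | zero => exact mul_zero _
        | add x y _ _ hx hy => rw [mul_add, hx, hy]
        | smul k x _ hx => rw [mul_smul_comm, hx]
      rw [hux]
      exact ih (ghostBounded_mul_edge e hx) he
    push Not at he
    have hxe : ∀ e, x * edge K E e = 0 := fun e => by
      by_cases h : E.s e = v
      · exact he e h
      · rw [← ghostBounded_mul_vertex hx, mul_assoc, vertex_mul_edge_of_ne (Ne.symm h), mul_zero]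
    obtain ⟨l, z, F, hl, hz, rfl⟩ := exists_eq_linearCombination_add hx
    have hz0 : (∀ e, z * edge K E e = 0) → z = 0 := fun h => by
      rw [← hz F subset_rfl, Finset.mul_sum]
      exact Finset.sum_eq_zero fun e _ => by rw [← mul_assoc, h, zero_mul]
    by_cases hl0 : l = 0
    · subst hl0
      rw [map_zero, zero_add] at hxe h0
      exact absurd (hz0 hxe) h0
    obtain hfin | hinf := {e | E.s e = v}.finite_or_infinite
    · obtain hempty | hne := {e | E.s e = v}.eq_empty_or_nonempty
      · have hv : ∀ e, v ≠ E.s e := fun e h => by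
          have : e ∈ {e | E.s e = v} := h.symm
          rw [hempty] at this
          exact this
        have hl' : Finsupp.linearCombination K (path K E · v) l * vertex K E v =
            Finsupp.linearCombination K (path K E · v) l := by
          rw [Finsupp.linearCombination_apply, Finsupp.sum, Finset.sum_mul]
          exact Finset.sum_congr rfl fun p _ => by rw [smul_mul_assoc, path_mul_vertex]
        rw [hz0, add_zero]
        · exact hasCornerReduction_linearCombination hl0 hl
        · intro e
          have := hxe e
          rwa [add_mul, ← hl', mul_assoc, vertex_mul_edge_of_ne (hv e), mul_zero, zero_add] at this
      · refine absurd ?_ h0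
        rw [← ghostBounded_mul_vertex hx, vertex_eq_sum ⟨hfin, hne⟩, Finset.mul_sum]
        exact Finset.sum_eq_zero fun e _ => by rw [← mul_assoc, hxe, zero_mul]
    · obtain ⟨a, k, s, γ, hk, hγ, h⟩ := exists_star_path_mul_eq (K := K) hl0 hl
      -- The edge `f` avoids the finitely many edges seen by `z`, so `z f = 0`, and those of the
      -- closed paths, so `f* γ f = 0`. Only `k r(f)` survives the compression by `f`.
      obtain ⟨f, hf, hfF⟩ := hinf.exists_notMem_finset (F ∪ s.biUnion fun i => (γ i).toFinset)
      obtain rfl : E.s f = v := hf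
      rw [Finset.mem_union, not_or, Finset.mem_biUnion] at hfF
      have hzf : z * edge K E f = 0 := by
        rw [← hz F subset_rfl, mul_assoc, Finset.sum_mul, Finset.sum_eq_zero, mul_zero]
        intro e heF
        rw [mul_assoc, ghost_mul_edge_of_ne, mul_zero]
        rintro rfl
        exact hfF.1 heF
      refine HasCornerReduction.of_mul_mul (a := ghost K E f * a) (b := edge K E f) ?_
      rw [mul_assoc, add_mul, hzf, add_zero, mul_assoc, ← mul_assoc a, h, ← mul_assoc, mul_add,
        add_mul, mul_smul_comm, ghost_mul_source, smul_mul_assoc, ghost_mul_edge_self,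
        Finset.mul_sum, Finset.sum_eq_zero, zero_mul]
      · simpa using hasCornerReduction_of_closed (K := K) (v := E.r f) hk ∅ id 0 (by simp)
      · intro i hi
        rw [mul_smul_comm]
        cases hi' : γ i with
        | nil => exact absurd hi' (hγ i hi).1
        | cons e p =>
          rw [path_cons, ← mul_assoc, ghost_mul_edge_of_ne, zero_mul, smul_zero]
          rintro rfl
          exact hfF.2 ⟨i, hi, by simp [hi']⟩

theorem exists_vertex_mul_ne_zero {x : E.LeavittPathAlgebra K} (hx : x ≠ 0) :
    ∃ u, vertex K E u * x ≠ 0 := by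
  obtain ⟨u, hu⟩ := exists_mul_vertex_ne_zero (star_ne_zero.2 hx)
  exact ⟨u, by rwa [← star_ne_zero, star_mul, star_vertex]⟩

theorem hasCornerReduction {x : E.LeavittPathAlgebra K} (hx : x ≠ 0) : HasCornerReduction x := by
  obtain ⟨v, hv⟩ := exists_mul_vertex_ne_zero hx
  obtain ⟨u, hu⟩ := exists_vertex_mul_ne_zero hv
  rw [← mul_assoc] at hu
  obtain ⟨n, hn⟩ := exists_mem_ghostBounded u v x
  exact (hasCornerReduction_of_mem_ghostBounded hn hu).of_mul_mul

end DirGraph.LeavittPathAlgebra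

/-! ### Minimal one-sided ideals in rings without unit -/

section Socle

variable {R : Type*} [NonUnitalRing R]

/-- `R z` is a left ideal inside `M`. In the absence of a unit, the element `u` guarantees that it
contains `z` and so is not zero. -/
theorem IsMinimalLeftIdeal.exists_eq_mul {M : AddSubgroup R} (hM : IsMinimalLeftIdeal R M)
    {u z m : R} (hz : z ∈ M) (hz0 : z ≠ 0) (hu : u * z = z) (hm : m ∈ M) : ∃ y, m = y * z := by
  obtain h | h := hM.2.2 (AddMonoidHom.mulRight z).range
    (by rintro a _ ⟨y, rfl⟩; exact ⟨a * y, mul_assoc a y z⟩)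
    (by rintro _ ⟨y, rfl⟩; exact hM.1 y z hz)
  · have : z ∈ (AddMonoidHom.mulRight z).range := ⟨u, hu⟩
    rw [h] at this
    exact absurd (AddSubgroup.mem_bot.1 this) hz0
  · rw [← h] at hm
    obtain ⟨y, rfl⟩ := hm
    exact ⟨y, rfl⟩

/-- A left ideal inside `M b` pulls back to a left ideal inside `M`, which is `0` or `M`. This makes
the left socle a two-sided ideal. -/
theorem IsMinimalLeftIdeal.map_mulRight {M : AddSubgroup R} (hM : IsMinimalLeftIdeal R M) (b : R) :
    M.map (AddMonoidHom.mulRight b) = ⊥ ∨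
      IsMinimalLeftIdeal R (M.map (AddMonoidHom.mulRight b)) := by
  refine or_iff_not_imp_left.2 fun h => ⟨?_, h, fun J hJ hJM => ?_⟩
  · rintro a _ ⟨x, hx, rfl⟩
    exact ⟨a * x, hM.1 a x hx, mul_assoc a x b⟩
  · obtain h | h := hM.2.2 (M ⊓ J.comap (AddMonoidHom.mulRight b))
      (fun a x hx => ⟨hM.1 a x hx.1, by
        have := hJ a _ hx.2
        change a * x * b ∈ J
        rwa [mul_assoc]⟩) inf_le_left
    · left
      rw [eq_bot_iff]
      intro y hy
      obtain ⟨x, hx, rfl⟩ := hJM hy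
      have : x ∈ M ⊓ J.comap (AddMonoidHom.mulRight b) := ⟨hx, hy⟩
      rw [h] at this
      rw [AddSubgroup.mem_bot.1 this, map_zero]
      exact zero_mem _
    · right
      refine le_antisymm hJM ?_
      rintro _ ⟨x, hx, rfl⟩
      rw [SetLike.mem_coe, ← h] at hx
      exact hx.2

theorem leftSocle_mul_mem_left (a : R) {x : R} (hx : x ∈ leftSocle R) : a * x ∈ leftSocle R := by
  suffices leftSocle R ≤ (leftSocle R).comap (AddMonoidHom.mulLeft a) from this hx
  exact sSup_le fun M hM x hx => le_sSup (a := M) hM (hM.1 a x hx)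

theorem leftSocle_mul_mem_right (b : R) {x : R} (hx : x ∈ leftSocle R) : x * b ∈ leftSocle R := by
  suffices leftSocle R ≤ (leftSocle R).comap (AddMonoidHom.mulRight b) from this hx
  refine sSup_le fun M hM => AddSubgroup.map_le_iff_le_comap.1 ?_
  obtain h | h := hM.map_mulRight b
  · rw [h]; exact bot_le
  · exact le_sSup h

/-- If `u` is idempotent and every nonzero element of `R u` generates `u`, then `u` lies in the left
socle. -/
theorem mem_leftSocle_of_idempotent {u : R} (hu : u * u = u)
    (h : ∀ y : R, y * u ≠ 0 → ∃ z, u = z * (y * u)) : u ∈ leftSocle R := by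
  by_cases h0 : u = 0
  · rw [h0]; exact zero_mem _
  have hmem : u ∈ (AddMonoidHom.mulRight u).range := ⟨u, hu⟩
  suffices hmin : IsMinimalLeftIdeal R (AddMonoidHom.mulRight u).range from
    (le_sSup hmin : _ ≤ leftSocle R) hmem
  refine ⟨?_, ?_, fun J hJ hJu => ?_⟩
  · rintro a _ ⟨y, rfl⟩; exact ⟨a * y, mul_assoc a y u⟩
  · intro hbot
    rw [hbot] at hmem
    exact h0 (AddSubgroup.mem_bot.1 hmem)
  · refine or_iff_not_imp_left.2 fun hJ0 => le_antisymm hJu ?_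
    obtain ⟨x, hx, hx0⟩ := (AddSubgroup.bot_or_exists_ne_zero J).resolve_left hJ0
    obtain ⟨y, rfl⟩ := hJu hx
    obtain ⟨z, hz⟩ := h y hx0
    rintro _ ⟨a, rfl⟩
    change a * u ∈ J
    rw [hz]
    exact hJ a _ (hJ z _ hx)

section Star

variable [StarRing R]

theorem IsMinimalLeftIdeal.comap_star {M : AddSubgroup R} (hM : IsMinimalLeftIdeal R M) :
    IsMinimalRightIdeal R (M.comap (starAddEquiv : R ≃+ R).toAddMonoidHom) := by
  refine ⟨fun a x hx => ?_, fun h => hM.2.1 ?_, fun J hJ hJM => ?_⟩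
  · change star (x * a) ∈ M
    rw [star_mul]
    exact hM.1 _ _ hx
  · rw [eq_bot_iff] at h ⊢
    intro x hx
    have : star x = 0 := h (show star (star x) ∈ M by rwa [star_star])
    exact star_eq_zero.1 this
  · obtain h | h := hM.2.2 (J.comap (starAddEquiv : R ≃+ R).toAddMonoidHom)
      (fun a x hx => by
        change star (a * x) ∈ J
        rw [star_mul]
        exact hJ _ _ hx)
      (fun x hx => by
        have : star (star x) ∈ M := hJM hx
        rwa [star_star] at this)
    · left
      rw [eq_bot_iff] at h ⊢
      intro x hx
      have : star x = 0 := h (show star (star x) ∈ J by rwa [star_star])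
      exact star_eq_zero.1 this
    · right
      refine le_antisymm hJM fun x hx => ?_
      have : star x ∈ M := hx
      rw [← h] at this
      have : star (star x) ∈ J := this
      rwa [star_star] at this

theorem IsMinimalRightIdeal.comap_star {M : AddSubgroup R} (hM : IsMinimalRightIdeal R M) :
    IsMinimalLeftIdeal R (M.comap (starAddEquiv : R ≃+ R).toAddMonoidHom) := by
  refine ⟨fun a x hx => ?_, fun h => hM.2.1 ?_, fun J hJ hJM => ?_⟩
  · change star (a * x) ∈ M
    rw [star_mul]
    exact hM.1 _ _ hx
  · rw [eq_bot_iff] at h ⊢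
    intro x hx
    have : star x = 0 := h (show star (star x) ∈ M by rwa [star_star])
    exact star_eq_zero.1 this
  · obtain h | h := hM.2.2 (J.comap (starAddEquiv : R ≃+ R).toAddMonoidHom)
      (fun a x hx => by
        change star (x * a) ∈ J
        rw [star_mul]
        exact hJ _ _ hx)
      (fun x hx => by
        have : star (star x) ∈ M := hJM hx
        rwa [star_star] at this)
    · left
      rw [eq_bot_iff] at h ⊢
      intro x hx
      have : star x = 0 := h (show star (star x) ∈ J by rwa [star_star])
      exact star_eq_zero.1 this
    · right
      refine le_antisymm hJM fun x hx => ?_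
      have : star x ∈ M := hx
      rw [← h] at this
      have : star (star x) ∈ J := this
      rwa [star_star] at this

/-- In a ring with involution, the involution exchanges the left socle and the right socle. -/
theorem mem_rightSocle_iff_star_mem {x : R} : x ∈ rightSocle R ↔ star x ∈ leftSocle R := by
  constructor
  · suffices rightSocle R ≤ (leftSocle R).comap (starAddEquiv : R ≃+ R).toAddMonoidHom from
      fun h => this h
    refine sSup_le fun M hM x hx => le_sSup (α := AddSubgroup R) hM.comap_star ?_
    change star (star x) ∈ M
    rwa [star_star]
  · suffices leftSocle R ≤ (rightSocle R).comap (starAddEquiv : R ≃+ R).toAddMonoidHom by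
      intro h
      have h' : star (star x) ∈ rightSocle R := this h
      rwa [star_star] at h'
    refine sSup_le fun M hM x hx => le_sSup (α := AddSubgroup R) hM.comap_star ?_
    change star (star x) ∈ M
    rwa [star_star]

end Star

end Socle

/-! ### The socle and the line points -/

namespace DirGraph.LeavittPathAlgebra

open LaurentPolynomial

variable {K : Type*} [Field K] {V A : Type*} {E : DirGraph V A}

/-- The elements whose star lies in the ideal form a two-sided ideal, and it contains `X` because
vertices are self-adjoint. -/
theorem star_mem_idealOf {X : Set V} {x : E.LeavittPathAlgebra K} (hx : x ∈ idealOf K E X) :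
    star x ∈ idealOf K E X := by
  let I : TwoSidedIdeal (E.LeavittPathAlgebra K) :=
    .mk' {x | star x ∈ idealOf K E X} (by simp [zero_mem])
      (fun {x y} hx hy => by
        rw [Set.mem_ofPred_eq, star_add]; exact add_mem hx hy)
      (fun {x} hx => by rw [Set.mem_ofPred_eq, star_neg]; exact neg_mem hx)
      (fun {x y} hy => by
        rw [Set.mem_ofPred_eq, star_mul]; exact TwoSidedIdeal.mul_mem_right _ _ _ hy)
      (fun {x y} hx => by
        rw [Set.mem_ofPred_eq, star_mul]; exact TwoSidedIdeal.mul_mem_left _ _ _ hx)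
  have : idealOf K E X ≤ I := TwoSidedIdeal.span_le.2 <| by
    rintro _ ⟨v, hv, rfl⟩
    refine (TwoSidedIdeal.mem_mk' _ _ _ _ _ _ _).2 ?_
    rw [Set.mem_ofPred_eq, star_vertex]
    exact TwoSidedIdeal.subset_span ⟨v, hv, rfl⟩
  exact (TwoSidedIdeal.mem_mk' {x | star x ∈ idealOf K E X} _ _ _ _ _ x).1 (this hx)

theorem vertex_mem_idealOf {X : Set V} {v : V} (hv : v ∈ X) : vertex K E v ∈ idealOf K E X :=
  TwoSidedIdeal.subset_span ⟨v, hv, rfl⟩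

variable (K E) in
/-- A set of vertices and its hereditary saturated closure generate the same ideal. -/
theorem idealOf_hsClosure (X : Set V) : idealOf K E (E.hsClosure X) = idealOf K E X := by
  refine le_antisymm (TwoSidedIdeal.span_le.2 ?_) (TwoSidedIdeal.span_mono ?_)
  · rintro _ ⟨v, hv, rfl⟩
    -- The vertices in the ideal form a hereditary and saturated set: `w = p* v p` for a path `p`
    -- from `v` to `w`, and `v = ∑ e r(e) e*` for regular `v`.
    refine hv {v | vertex K E v ∈ idealOf K E X} ⟨fun v hv => vertex_mem_idealOf hv, ?_, ?_⟩
    · rintro v hv w ⟨p, hp⟩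
      change vertex K E w ∈ idealOf K E X
      rw [← star_path_mul_path_self hp, ← vertex_mul_path hp, ← mul_assoc]
      exact TwoSidedIdeal.mul_mem_right _ _ _ (TwoSidedIdeal.mul_mem_left _ _ _ hv)
    · intro v hv h
      change vertex K E v ∈ idealOf K E X
      rw [vertex_eq_sum hv]
      refine sum_mem fun e he => TwoSidedIdeal.mul_mem_right _ _ _ ?_
      rw [← edge_mul_range]
      exact TwoSidedIdeal.mul_mem_left _ _ _ (h e (by simpa using he))
  · exact Set.image_mono (Set.subset_sInter fun H hH => hH.1)

/-- A minimal left ideal cannot be moved into a corner at a vertex without bifurcations in its tree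
that lies on a closed path. -/
theorem not_isMinimalLeftIdeal_of_closed (c : E.Coding) {v : V}
    (h : ∀ x ∈ E.tree v, ¬ E.IsBifurcation x) {p : List A} (hp : E.IsPath v p v) (hp0 : p ≠ [])
    {M : AddSubgroup (E.LeavittPathAlgebra K)} {m b : E.LeavittPathAlgebra K} (hm : m ∈ M)
    (hvm : vertex K E v * m = m) {a : K[T;T⁻¹]} (ha : a ≠ 0)
    (hmb : c.rep K (m * b) (Coding.indicator K v) = a • Coding.indicator K v) :
    ¬ IsMinimalLeftIdeal (E.LeavittPathAlgebra K) M := by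
  intro hM
  set d := vertex K E v - path K E p v with hd
  have hvd : vertex K E v * d = d := by rw [hd, mul_sub, vertex_mul_self, vertex_mul_path hp]
  have hrep : c.rep K (d * (m * b)) (Coding.indicator K v) =
      (a * (1 - T p.length)) • Coding.indicator K v := by
    rw [map_mul, Module.End.mul_apply, hmb, map_smul, hd, map_sub, LinearMap.sub_apply,
      c.rep_vertex_indicator, c.rep_path_indicator hp h, mul_smul, sub_smul, one_smul]
  -- Otherwise `a * (1 - T ^ n) = 0` with `n` the length of `p`, which is positive.
  have hdm : d * m ≠ 0 := by
    intro h0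
    rw [← mul_assoc, h0, zero_mul, map_zero, LinearMap.zero_apply] at hrep
    have := Coding.smul_indicator_inj ((zero_smul _ _).trans hrep)
    rw [zero_eq_mul, sub_eq_zero] at this
    have h1 := (this.resolve_left ha).trans (Polynomial.toLaurent_X_pow p.length).symm
    rw [← map_one Polynomial.toLaurent] at h1
    have h2 := congrArg Polynomial.natDegree (Polynomial.toLaurent_injective h1)
    rw [Polynomial.natDegree_one, Polynomial.natDegree_X_pow] at h2
    exact hp0 (List.eq_nil_of_length_eq_zero h2.symm)
  obtain ⟨y, hy⟩ := hM.exists_eq_mul (hM.1 d m hm) hdm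
    (show vertex K E v * (d * m) = d * m by rw [← mul_assoc, hvd]) hm
  obtain ⟨a', ha'⟩ := c.exists_rep_indicator h y
  -- From `m = y (d m)`, comparison of scalars gives `a = a * (1 - T ^ n) * a'`, so `1 - T ^ n`
  -- would be a unit.
  have key : m * b = vertex K E v * y * vertex K E v * (d * (m * b)) := by
    conv_lhs => rw [← hvm, hy, ← hvd]
    simp only [mul_assoc]
  rw [key, map_mul, Module.End.mul_apply, hrep, map_smul, ha', smul_smul] at hmb
  have := Coding.smul_indicator_inj hmb
  rw [mul_assoc, mul_comm _ a'] at this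
  exact Coding.one_sub_T_mul_ne_one _ _ (mul_left_cancel₀ ha (this.trans (mul_one a).symm))

theorem mem_idealOf_linePoints_of_isMinimalLeftIdeal [Countable A]
    {M : AddSubgroup (E.LeavittPathAlgebra K)} (hM : IsMinimalLeftIdeal _ M)
    {x : E.LeavittPathAlgebra K} (hx : x ∈ M) : x ∈ idealOf K E E.linePoints := by
  obtain ⟨C⟩ := E.exists_coding
  by_cases hx0 : x = 0
  · rw [hx0]; exact zero_mem _
  obtain ⟨v, a, b, k, s, γ, c, hk, ha, hγ, hs, h⟩ := hasCornerReduction hx0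
  have hm : a * x ∈ M := hM.1 a x hx
  have hvm : vertex K E v * (a * x) = a * x := by rw [← mul_assoc, ha]
  set m := a * x
  obtain rfl | ⟨i, hi⟩ := s.eq_empty_or_nonempty
  · rw [Finset.sum_empty, add_zero] at h
    have hmul : ∀ {w} {p : List A} (y : E.LeavittPathAlgebra K), E.IsPath v p w →
        y * m * (b * path K E p w) = k • (y * path K E p w) := fun y hp => by
      rw [mul_assoc, ← mul_assoc m, h, smul_mul_assoc, vertex_mul_path hp, mul_smul_comm]
    have hbif : ∀ w ∈ E.tree v, ¬ E.IsBifurcation w := by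
      rintro w ⟨p, hp⟩ ⟨e, rfl, f, hf, hef⟩
      have hpe := hp.append (.single e)
      have hpf := (show E.s f = E.s e from hf) ▸ hp |>.append (.single f)
      -- By minimality `m = y (p e)* m`. Multiplying by `(p f)*` on the left and by `b (p f)` on the
      -- right gives `k r(f)` on one side and, since `(p e)* (p f) = 0`, zero on the other.
      have hz : star (path K E (p ++ [e]) (E.r e)) * m ≠ 0 := by
        intro h0
        have := hmul (star (path K E (p ++ [e]) (E.r e))) hpe
        rw [h0, zero_mul, star_path_mul_path_self hpe] at this
        exact smul_ne_zero hk (vertex_ne_zero K E _) this.symm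
      obtain ⟨y, hy⟩ := hM.exists_eq_mul (hM.1 _ m hm) hz
        (by rw [← mul_assoc, vertex_mul_star_path]) hm
      have h₁ := hmul (star (path K E (p ++ [f]) (E.r f)) * y * star (path K E (p ++ [e]) (E.r e)))
        hpf
      rw [mul_assoc _ _ (path K E (p ++ [f]) (E.r f)), star_path_mul_path_of_not_prefix hpe hpf
        (by simp) (by simpa using hef), mul_zero, smul_zero, mul_assoc _ _ m, mul_assoc _ y, ← hy,
        hmul _ hpf, star_path_mul_path_self hpf] at h₁
      exact smul_ne_zero hk (vertex_ne_zero K E _) h₁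
    have hline : v ∈ E.linePoints := by
      refine fun w hw => ⟨hbif w hw, fun p hp => ?_⟩
      obtain ⟨q, hq⟩ := hw
      -- The path `q` moves the corner from `v` to the base `w` of the cycle: `q* m b q = k w`.
      refine not_isMinimalLeftIdeal_of_closed C
        (fun x hx => hbif x (tree_subset_of_mem ⟨q, hq⟩ hx)) hp.2.1 hp.1
        (m := star (path K E q w) * m) (b := b * path K E q w) (a := k • 1) (hM.1 _ m hm)
        (by rw [← mul_assoc, vertex_mul_star_path]) (smul_ne_zero hk one_ne_zero) ?_ hM
      rw [hmul _ hq, star_path_mul_path_self hq, map_smul, LinearMap.smul_apply,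
        C.rep_vertex_indicator, smul_assoc, one_smul]
    have hm0 : m ≠ 0 := by
      intro h0
      rw [h0, zero_mul] at h
      exact smul_ne_zero hk (vertex_ne_zero K E _) h.symm
    obtain ⟨y, hy⟩ := hM.exists_eq_mul hm hm0 hvm hx
    rw [hy, ← hvm]
    exact TwoSidedIdeal.mul_mem_left _ _ _
      (TwoSidedIdeal.mul_mem_right _ _ _ (vertex_mem_idealOf hline))
  · have htree := hs.resolve_left (Finset.ne_empty_of_mem hi)
    -- Each closed path acts as `T` to its length, so `m b` acts as this polynomial. It is nonzero:
    -- the lengths are positive, so its constant coefficient is `k`.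
    refine absurd hM (not_isMinimalLeftIdeal_of_closed C htree (hγ i hi).2 (hγ i hi).1 hm hvm
      (b := b) (a := Polynomial.toLaurent
        (Polynomial.C k + ∑ i ∈ s, Polynomial.C (c i) * Polynomial.X ^ (γ i).length)) ?_ ?_)
    · rw [Ne, map_eq_zero_iff _ Polynomial.toLaurent_injective]
      intro h0
      have := congrArg (Polynomial.coeff · 0) h0
      simp only [Polynomial.coeff_add, Polynomial.coeff_C_zero, Polynomial.finsetSum_coeff,
        Polynomial.coeff_C_mul, Polynomial.coeff_zero] at this
      rw [Finset.sum_eq_zero, add_zero] at this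
      · exact hk this
      · intro j hj
        rw [Polynomial.coeff_X_pow, if_neg, mul_zero]
        exact fun h0 => (hγ j hj).1 (List.eq_nil_of_length_eq_zero h0.symm)
    · have hC : ∀ (k : K) (f : Coding.Functions K V),
          (LaurentPolynomial.C k : K[T;T⁻¹]) • f = k • f := fun k f => by
        ext1 x
        rw [Pi.smul_apply, Pi.smul_apply, LaurentPolynomial.smul_eq_C_mul, smul_eq_mul]
      rw [h, map_add, map_smul, map_sum, LinearMap.add_apply, LinearMap.smul_apply,
        C.rep_vertex_indicator, LinearMap.sum_apply, map_add, map_sum, add_smul, Finset.sum_smul,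
        Polynomial.toLaurent_C, hC]
      congr 1
      refine Finset.sum_congr rfl fun j hj => ?_
      rw [map_smul, LinearMap.smul_apply, C.rep_path_indicator (hγ j hj).2 htree, map_mul,
        Polynomial.toLaurent_C, Polynomial.toLaurent_X_pow, mul_smul, hC]

/-- Induction on the ghost length. If `v` emits its only edge `e`, then `v = e e*`, so `x e` is
nonzero with a smaller bound; from `r(e) = z x e` follows `v = e r(e) e* = e z x`. Without ghost
edges, a shortest path turns `x` into `k v`, since closed paths would run through a cycle. -/
theorem exists_eq_mul_of_mem_linePoints {n : ℕ} {u v : V} (hv : v ∈ E.linePoints)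
    {x : E.LeavittPathAlgebra K} (hx : x ∈ ghostBounded K E n u v) (hx0 : x ≠ 0) :
    ∃ z, vertex K E v = z * x := by
  have base : ∀ {v} {x : E.LeavittPathAlgebra K}, v ∈ E.linePoints → x ∈ ghostBounded K E 0 u v →
      x ≠ 0 → ∃ z, vertex K E v = z * x := by
    intro v x hv hx hx0
    obtain ⟨l, hl, rfl⟩ := exists_linearCombination_of_mem_ghostBounded_zero hx
    obtain ⟨a, k, s, γ, hk, hγ, h⟩ := exists_star_path_mul_eq (K := K) (l := l)
      (by rintro rfl; exact hx0 (map_zero _)) hl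
    obtain rfl : s = ∅ := by
      refine Finset.eq_empty_of_forall_notMem fun i hi => ?_
      obtain ⟨w, hw, p, hp⟩ := exists_isCycleAt_of_closed (hγ i hi).2 (hγ i hi).1
      exact (hv w hw).2 p hp
    refine ⟨k⁻¹ • a, ?_⟩
    rw [smul_mul_assoc, h, Finset.sum_empty, add_zero, smul_smul, inv_mul_cancel₀ hk, one_smul]
  induction n generalizing v x with
  | zero => exact base hv hx hx0
  | succ n ih =>
    by_cases he : ∃ e, E.s e = v
    · obtain ⟨e, rfl⟩ := he
      have hset : ∀ f, E.s f = E.s e → f = e := fun f hf =>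
        by_contra fun hne => (hv _ (mem_tree_self _)).1 ⟨f, hf, e, rfl, hne⟩
      have hreg : E.IsRegular (E.s e) :=
        ⟨(Set.finite_singleton e).subset fun f hf => hset f hf, e, rfl⟩
      have hee : vertex K E (E.s e) = edge K E e * ghost K E e := by
        rw [vertex_eq_sum hreg, Finset.sum_eq_single_of_mem e (by simp)]
        intro f hf hne
        exact absurd (hset f (by simpa using hf)) hne
      have hxe : x = x * edge K E e * ghost K E e := by
        rw [mul_assoc, ← hee, ghostBounded_mul_vertex hx]
      obtain ⟨z, hz⟩ := ih (fun w hw => hv w (tree_subset_of_mem ⟨[e], .single e⟩ hw))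
        (ghostBounded_mul_edge e hx) (fun h0 => hx0 (by rw [hxe, h0, zero_mul]))
      refine ⟨edge K E e * z, ?_⟩
      rw [hee, hxe]
      conv_lhs => rw [← edge_mul_range, hz]
      simp only [mul_assoc]
    -- At a sink every ghost path is trivial.
    · refine base hv (Submodule.span_mono ?_ hx) hx0
      rintro _ ⟨p, q, w, hp, hq, _, rfl⟩
      cases q with
      | nil => exact ⟨p, [], w, hp, hq, le_rfl, rfl⟩
      | cons f q => exact absurd ⟨f, hq.source_eq.symm⟩ he

theorem vertex_mem_leftSocle {v : V} (hv : v ∈ E.linePoints) :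
    vertex K E v ∈ leftSocle (E.LeavittPathAlgebra K) := by
  refine mem_leftSocle_of_idempotent (vertex_mul_self v) fun y hy => ?_
  obtain ⟨u, hu⟩ := exists_vertex_mul_ne_zero hy
  rw [← mul_assoc] at hu
  obtain ⟨n, hn⟩ := exists_mem_ghostBounded u v y
  obtain ⟨z, hz⟩ := exists_eq_mul_of_mem_linePoints hv hn hu
  exact ⟨z * vertex K E u, hz.trans (by simp only [mul_assoc])⟩

theorem mem_leftSocle_iff [Countable A] {x : E.LeavittPathAlgebra K} :
    x ∈ leftSocle (E.LeavittPathAlgebra K) ↔ x ∈ idealOf K E E.linePoints := by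
  constructor
  · suffices leftSocle (E.LeavittPathAlgebra K) ≤
        AddSubgroup.ofClass (idealOf K E E.linePoints) from fun h => this h
    exact sSup_le fun M hM y hy => mem_idealOf_linePoints_of_isMinimalLeftIdeal hM hy
  · let I : TwoSidedIdeal (E.LeavittPathAlgebra K) :=
      .mk' (leftSocle (E.LeavittPathAlgebra K)) (zero_mem _) add_mem neg_mem
        (leftSocle_mul_mem_left _) (leftSocle_mul_mem_right _)
    have : idealOf K E E.linePoints ≤ I := TwoSidedIdeal.span_le.2 <| by
      rintro _ ⟨v, hv, rfl⟩
      exact (TwoSidedIdeal.mem_mk' _ _ _ _ _ _ _).2 (vertex_mem_leftSocle hv)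
    exact fun hx => (TwoSidedIdeal.mem_mk' (leftSocle (E.LeavittPathAlgebra K) : Set _)
      _ _ _ _ _ x).1 (this hx)

end DirGraph.LeavittPathAlgebra

/-- The socle of `L_K(E)` is at once the sum of all minimal left ideals and the sum of all minimal
right ideals; it equals the ideal generated by the line points of `E`, and also the ideal generated
by their hereditary saturated closure. -/
theorem mainTheorem1 {K : Type*} [Field K] {V A : Type*} [Countable V] [Countable A]
    (E : DirGraph V A) :
    (leftSocle (E.LeavittPathAlgebra K) : Set (E.LeavittPathAlgebra K)) =
        DirGraph.LeavittPathAlgebra.idealOf K E E.linePoints ∧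
      (rightSocle (E.LeavittPathAlgebra K) : Set (E.LeavittPathAlgebra K)) =
        DirGraph.LeavittPathAlgebra.idealOf K E E.linePoints ∧
      DirGraph.LeavittPathAlgebra.idealOf K E E.linePoints =
        DirGraph.LeavittPathAlgebra.idealOf K E (E.hsClosure E.linePoints) := by
  open DirGraph.LeavittPathAlgebra in
  refine ⟨Set.ext fun x => mem_leftSocle_iff, Set.ext fun x => ?_,
    (idealOf_hsClosure K E _).symm⟩
  rw [SetLike.mem_coe, mem_rightSocle_iff_star_mem, mem_leftSocle_iff]
  exact ⟨fun h => star_star x ▸ star_mem_idealOf h, star_mem_idealOf⟩
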